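/- Let $(G,d)$ be a complete CAT($\kappa$) space with $\kappa>0$ and let $f,g:G\to\mathbb R\cup\{+\infty\}$ be proper, lower semicontinuous and convex (along every geodesic). For $\lambda>0$ write $\operatorname{prox}_{f,\lambda}(x)=\operatorname{argmin}_{y\in G}\, f(y)+\tfrac1{2\lambda}d(y,x)^2$, write $P_C$ for the metric projector onto $C$, and write $\beta\, p\oplus(1-\beta)x$ for the point at distance $\beta d(x,p)$ from $x$ on a geodesic from $x$ to $p$. For $1<c<2$ put $$\alpha_c=\frac{c(c-1)}{c(c-1)+2},\qquad \epsilon_c=\frac{2-c}{c-1},\qquad a_0\circ_c a_1=\frac{a_0+a_1-2a_0a_1}{\frac c2(1-a_0-a_1+a_0a_1)+a_0+a_1-2a_0a_1}.$$ Let $D\subset G$ be closed, let $T$ map $D$ into $D$, and let $T$ be on $D$ (a selection of) one of the following mappings ($\lambda,\lambda_1,\lambda_2>0$, $0<\beta\le1$), with the indicated set $\Omega$, constant $\alpha=\alpha(c)$, violation $\epsilon=\epsilon(c)$ and asymptotic constant $\overline\alpha$: (i) $T=\operatorname{prox}_{f,\lambda_2}\circ\operatorname{prox}_{g,\lambda_1}$;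 $\Omega=\operatorname{argmin}f\cap\operatorname{argmin}g$, $\alpha=\frac{2(c-1)}{2c-1}$, $\epsilon=\frac1{(c-1)^2}-1$, $\overline\alpha=\frac23$. (ii) $T=\operatorname{prox}_{f,\lambda}\circ T_0$ with $T_0:G\to G$; $\Omega=\operatorname{argmin}f\cap\operatorname{Fix}T_0$, where, for some $\overline\alpha_0\in(0,1)$, the mapping $T_0$ is asymptotically $\overline\alpha_0$-firmly nonexpansive at $\Omega\cap D$, locally uniformly: for every $y\in\Omega\cap D$ and $\epsilon_0>0$ there is $r>0$ with $d(T_0x,T_0z)^2\le(1+\epsilon_0)d(x,z)^2-\frac{1-\overline\alpha_0}{\overline\alpha_0}\big(d(T_0x,x)^2+d(T_0z,z)^2+d(T_0x,T_0z)^2+d(x,z)^2-d(T_0x,z)^2-d(x,T_0z)^2\big)$ for all $x\in D$, $z\in\Omega\cap D$ within distance less than $r$ of $y$; and $T_0$ is quasi nonexpansive near $\Omega\cap D$: every $y\in\Omega\cap D$ has a neighbourhood in $D$ on which $d(T_0x,y)\le d(x,y)$. Here $\alpha=\overline\alpha_0\circ_c\alpha_c$, $\epsilon=\epsilon_0+\epsilon_c+\epsilon_0\epsilon_c$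 with $\epsilon_0>0$ arbitrary, and $\overline\alpha=\frac1{2-\overline\alpha_0}$. (iii) $T=\beta\operatorname{prox}_{f,\lambda}\oplus(1-\beta)\mathrm{Id}$; $\Omega=\operatorname{argmin}f$, $\alpha=\beta\alpha_c$, $\epsilon=\beta\epsilon_c$, $\overline\alpha=\frac\beta2$. (iv) $T=\operatorname{prox}_{f,\lambda_2}\circ(\beta\operatorname{prox}_{g,\lambda_1}\oplus(1-\beta)\mathrm{Id})$; $\Omega=\operatorname{argmin}f\cap\operatorname{argmin}g$, $\alpha=(\beta\alpha_c)\circ_c\alpha_c$, $\epsilon=(1+\beta)\epsilon_c+\beta\epsilon_c^2$, $\overline\alpha=\frac1{2-\beta/2}$. (v) $T=P_C\circ(\beta\operatorname{prox}_{g,\lambda}\oplus(1-\beta)\mathrm{Id})$ with $C\subset G$ closed and convex; $\Omega=C\cap\operatorname{argmin}g$, $\alpha=\frac1{\frac c2(1-\beta\alpha_c)+1}$, $\epsilon=\beta\epsilon_c$, $\overline\alpha=\frac1{2-\beta/2}$. Suppose that $T$ is linearly metrically subregular on $D$ with a constant $\mu>0$: $$d(x,\operatorname{Fix}T\cap D)\le\mu\,d(x,Tx)\qquad\forall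 x\in D .$$ With the convention $\sqrt s=0$ for $s<0$, put $$\gamma_c=\sqrt{1+\epsilon-\tfrac c2\,\tfrac{1-\alpha}{\alpha\mu^2}},\qquad \gamma_\varepsilon=\sqrt{1+\varepsilon-\tfrac{1-\overline\alpha}{\overline\alpha\mu^2}}\ (\varepsilon>0),\qquad \overline\gamma=\sqrt{1-\tfrac{1-\overline\alpha}{\overline\alpha\mu^2}} .$$ Then: (1) In cases (i), (iii), (iv), (v), every $x\in D$ at distance less than $\pi/(2\sqrt\kappa)$ from some point of $\Omega$ satisfies $Tx=x$ if and only if $x\in\Omega$. (In particular $\operatorname{Fix}T\cap D=\Omega\cap D$ if $\Omega\ne\emptyset$ and $\operatorname{diam}G<\pi/(2\sqrt\kappa)$.) (2) Let $\gamma$ be $\gamma_c$ for some $c\in(1,2)$ (and, in case (ii), some $\epsilon_0>0$), or $\gamma_\varepsilon$ for some $\varepsilon>0$, and suppose $\gamma<1$. Then there are $\delta,a>0$ such that for all $y\in\Omega\cap D$ and all $x^0\in D$ with $d(x^0,y)<\delta$ the iterates $x^{k+1}=Tx^k$ converge R-linearly with rate $\gamma$ to a point $x^*\in\operatorname{Fix}T\cap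 D$: for all $k$, $$d(x^{k+1},\operatorname{Fix}T\cap D)\le\gamma\, d(x^k,\operatorname{Fix}T\cap D),\qquad d(x^k,x^*)\le a\,\gamma^k d(x^0,\operatorname{Fix}T\cap D).$$ In case (ii), $\delta$ and $a$ may depend on $y$. (3) $\overline\gamma<1$, and $\gamma_c\to\overline\gamma$ as $c\nearrow2$ (and $\epsilon_0\searrow0$ in case (ii)). There is $\delta>0$ (depending on $y$ in case (ii)) such that for all $y\in\Omega\cap D$ and $x^0\in D$ with $d(x^0,y)<\delta$ the iterates converge to some $x^*\in\operatorname{Fix}T\cap D$ with asymptotic rate at most $\overline\gamma$: for every $\rho>\overline\gamma$, $d(x^{k+1},\operatorname{Fix}T\cap D)\le\rho\,d(x^k,\operatorname{Fix}T\cap D)$ for all large $k$, and $d(x^k,x^*)=O(\rho^k)$. -/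

import Mathlib

open Set Filter Topology

namespace ProxCAT

/-- `γ` restricted to `[0,1]` is a (constant speed, length minimizing) geodesic from `x` to `y`. -/
def IsGeodesic {G : Type*} [MetricSpace G] (γ : ℝ → G) (x y : G) : Prop :=
  γ 0 = x ∧ γ 1 = y ∧
    ∀ s ∈ Icc (0 : ℝ) 1, ∀ t ∈ Icc (0 : ℝ) 1, dist (γ s) (γ t) = |s - t| * dist x y

/-- The points `(1 - t) x ⊕ t y` (unique whenever the geodesic from `x` to `y` is). -/
def combo {G : Type*} [MetricSpace G] (t : ℝ) (x y : G) : Set G :=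
  {z | ∃ γ : ℝ → G, IsGeodesic γ x y ∧ γ t = z}

/-- The points of the model surface of constant curvature `κ > 0`, as directions in `ℝ³`. -/
abbrev Model : Type := Metric.sphere (0 : EuclideanSpace ℝ (Fin 3)) 1

/-- The intrinsic distance of the model surface of curvature `κ > 0`
(the round sphere of radius `1 / √κ`). -/
noncomputable def modelDist (κ : ℝ) (u v : Model) : ℝ :=
  InnerProductGeometry.angle (u : EuclideanSpace ℝ (Fin 3)) (v : EuclideanSpace ℝ (Fin 3)) / √κ

/-- `G` is a CAT(κ) space, `κ > 0`: points at distance `< π / √κ` are joined by a geodesic, and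
geodesic triangles of perimeter `< 2π / √κ` are not thicker than their comparison triangles
`p' q' r'` in the model surface. Here `γ s` and `η t` are points on two sides of the
triangle `p q r` and `u`, `v` are their comparison points. -/
structure IsCAT (κ : ℝ) (G : Type*) [MetricSpace G] : Prop where
  exists_geodesic : ∀ x y : G, dist x y < Real.pi / √κ → ∃ γ : ℝ → G, IsGeodesic γ x y
  comparison : ∀ (p q r : G), dist p q + dist q r + dist r p < 2 * Real.pi / √κ →
    ∀ (γ η : ℝ → G), IsGeodesic γ p q → IsGeodesic η p r →
    ∀ s ∈ Icc (0 : ℝ) 1, ∀ t ∈ Icc (0 : ℝ) 1, ∀ p' q' r' u v : Model,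
      modelDist κ p' q' = dist p q → modelDist κ q' r' = dist q r →
      modelDist κ r' p' = dist r p →
      modelDist κ p' u = s * dist p q → modelDist κ u q' = (1 - s) * dist p q →
      modelDist κ p' v = t * dist p r → modelDist κ v r' = (1 - t) * dist p r →
      dist (γ s) (η t) ≤ modelDist κ u v

/-- `f : G → ℝ ∪ {+∞}` is proper, convex (along every geodesic) and lower semicontinuous. -/
structure IsProperConvexLsc {G : Type*} [MetricSpace G] (f : G → EReal) : Prop where
  ne_bot : ∀ x, f x ≠ ⊥
  proper : ∃ x, f x ≠ ⊤
  convex : ∀ (x y : G) (γ : ℝ → G), IsGeodesic γ x y → ∀ t ∈ Icc (0 : ℝ) 1,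
    f (γ t) ≤ ((1 - t : ℝ) : EReal) * f x + (t : EReal) * f y
  lsc : LowerSemicontinuous f

/-- A set that contains every geodesic joining two of its points. -/
def IsGeodesicallyConvex {G : Type*} [MetricSpace G] (C : Set G) : Prop :=
  ∀ x ∈ C, ∀ y ∈ C, ∀ γ : ℝ → G, IsGeodesic γ x y → ∀ t ∈ Icc (0 : ℝ) 1, γ t ∈ C

/-- The set of global minimizers. -/
def argmin {G : Type*} (f : G → EReal) : Set G := {x | ∀ y, f x ≤ f y}

/-- The proximal mapping `argmin_y f y + d(y,x)² / (2 lam)`, as a set; it is a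
single point for `x` close to `argmin f`. -/
noncomputable def prox {G : Type*} [MetricSpace G] (f : G → EReal) (lam : ℝ) (x : G) : Set G :=
  argmin fun y => f y + ((dist y x ^ 2 / (2 * lam) : ℝ) : EReal)

/-- The metric projector onto `C`, as a set. -/
def proj {G : Type*} [MetricSpace G] (C : Set G) (x : G) : Set G :=
  {p | p ∈ C ∧ ∀ q ∈ C, dist p x ≤ dist q x}

/-- The transport discrepancy `ψ_T^{(2,c)}`. -/
noncomputable def psi {G : Type*} [MetricSpace G] (c : ℝ) (T : G → G) (x y : G) : ℝ :=
  c / 2 * (dist (T x) x ^ 2 + dist (T y) y ^ 2 + dist (T x) (T y) ^ 2 + dist x y ^ 2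
    - dist (T x) y ^ 2 - dist x (T y) ^ 2)

/-- `T` is asymptotically `α`-firmly nonexpansive at the points of `S` on `D`, the neighbourhoods
being locally uniform in the points of `S`. -/
def IsAsymptoticallyFirm {G : Type*} [MetricSpace G] (T : G → G) (D S : Set G) (α : ℝ) : Prop :=
  ∀ y ∈ S, ∀ ε > (0 : ℝ), ∃ r > (0 : ℝ), ∀ x ∈ D, ∀ z ∈ S, dist x y < r → dist z y < r →
    dist (T x) (T z) ^ 2 ≤ (1 + ε) * dist x z ^ 2 - (1 - α) / α * psi 2 T x z

/-- `T` is pointwise nonexpansive at each `y ∈ S` on a neighbourhood of `y` in `D`. -/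
def IsLocallyQuasiNonexpansive {G : Type*} [MetricSpace G] (T : G → G) (D S : Set G) : Prop :=
  ∀ y ∈ S, ∃ r > (0 : ℝ), ∀ x ∈ D, dist x y < r → dist (T x) (T y) ≤ dist x y

/-- The constant of almost firm nonexpansiveness of a prox mapping in a 2-uniformly convex space
with parameter `c`. -/
noncomputable def alphaProx (c : ℝ) : ℝ := c * (c - 1) / (c * (c - 1) + 2)

/-- The violation of firm nonexpansiveness of a prox mapping in a 2-uniformly convex space
with parameter `c`. -/
noncomputable def epsProx (c : ℝ) : ℝ := (2 - c) / (c - 1)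

/-- The constant of a composition of two mappings with constants `a₀` and `a₁`. -/
noncomputable def alphaComp (c a₀ a₁ : ℝ) : ℝ :=
  (a₀ + a₁ - 2 * a₀ * a₁) / (c / 2 * (1 - a₀ - a₁ + a₀ * a₁) + a₀ + a₁ - 2 * a₀ * a₁)

/-- The rate belonging to constant `α`, violation `ε` (both with respect to `ψ^{(2,c)}`, which
equals `(c/2) d(x,Tx)²` at fixed points) and subregularity constant `μ`. -/
noncomputable def rate (c α ε μ : ℝ) : ℝ :=
  √(1 + ε - c / 2 * ((1 - α) / (α * μ ^ 2)))

/-- Linear convergence with rate `γ` of the iterates of `T` from `x₀` to a point of `Fix T ∩ D`: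
linear monotonicity with respect to `Fix T ∩ D`, and R-linear convergence. -/
def ConvergesLinearly {G : Type*} [MetricSpace G] (T : G → G) (D : Set G) (γ a : ℝ) (x₀ : G) :
    Prop :=
  ∃ x' ∈ Function.fixedPoints T ∩ D, ∀ k : ℕ,
    Metric.infDist (T^[k + 1] x₀) (Function.fixedPoints T ∩ D) ≤
        γ * Metric.infDist (T^[k] x₀) (Function.fixedPoints T ∩ D) ∧
    dist (T^[k] x₀) x' ≤ a * γ ^ k * Metric.infDist x₀ (Function.fixedPoints T ∩ D)

/-- The iterates of `T` from `x₀` converge to a point of `Fix T ∩ D` with asymptotic rate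
(at most) `γ`. -/
def ConvergesAsymptotically {G : Type*} [MetricSpace G] (T : G → G) (D : Set G) (γ : ℝ) (x₀ : G) :
    Prop :=
  ∃ x' ∈ Function.fixedPoints T ∩ D, Tendsto (fun k : ℕ => T^[k] x₀) atTop (𝓝 x') ∧
    ∀ ρ > γ,
      (∀ᶠ k : ℕ in atTop, Metric.infDist (T^[k + 1] x₀) (Function.fixedPoints T ∩ D) ≤
        ρ * Metric.infDist (T^[k] x₀) (Function.fixedPoints T ∩ D)) ∧
      ∃ a : ℝ, ∀ k : ℕ, dist (T^[k] x₀) x' ≤ a * ρ ^ k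

/-- All starting points in `D` within a uniform distance of `S` give linear convergence
with rate `γ`. -/
def LinearNear {G : Type*} [MetricSpace G] (T : G → G) (D S : Set G) (γ : ℝ) : Prop :=
  ∃ δ > (0 : ℝ), ∃ a > (0 : ℝ), ∀ y ∈ S, ∀ x₀ ∈ D, dist x₀ y < δ → ConvergesLinearly T D γ a x₀

/-- The convergence statement for a mapping `T` with set of solutions `Ω`, whose constant and
violation with respect to the uniform convexity parameter `c` are `α c` and `ε c`, and whose
asymptotic constant is `αbar`. -/
def ConvergenceNear {G : Type*} [MetricSpace G] (T : G → G) (D Ω : Set G) (μ : ℝ)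
    (α ε : ℝ → ℝ) (αbar : ℝ) : Prop :=
  (∀ c ∈ Ioo (1 : ℝ) 2, rate c (α c) (ε c) μ < 1 →
    LinearNear T D (Ω ∩ D) (rate c (α c) (ε c) μ)) ∧
  (∀ e > (0 : ℝ), rate 2 αbar e μ < 1 → LinearNear T D (Ω ∩ D) (rate 2 αbar e μ)) ∧
  Tendsto (fun c => rate c (α c) (ε c) μ) (𝓝[<] 2) (𝓝 (rate 2 αbar 0 μ)) ∧
  rate 2 αbar 0 μ < 1 ∧
  ∃ δ > (0 : ℝ), ∀ y ∈ Ω ∩ D, ∀ x₀ ∈ D, dist x₀ y < δ →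
    ConvergesAsymptotically T D (rate 2 αbar 0 μ) x₀

/-- Within distance `π / (2√κ)` of any point of `Ω`, the fixed points of `T` in `D` are exactly
the points of `Ω` in `D`. -/
def FixedPointsAre {G : Type*} [MetricSpace G] (κ : ℝ) (T : G → G) (D Ω : Set G) : Prop :=
  ∀ x ∈ D, ∀ y ∈ Ω, dist x y < Real.pi / (2 * √κ) → (T x = x ↔ x ∈ Ω)

end ProxCAT

/-! A proximal point, or a metric projection, `p` of `x` is a foot point: no point of the geodesic
from `p` to a point `y` of the solution set is closer to `x`. Comparison with the sphere of
curvature `κ` turns this into the spherical Pythagorean inequality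
`cos (√κ d(x,y)) ≤ cos (√κ d(p,x)) * cos (√κ d(p,y))`. Within distance `π / (2√κ)` it shows that
`p` is strictly closer to `y` than `x` unless `p = x`, which identifies the fixed points; near the
solution set it is almost the flat inequality `d(p,x)² + d(p,y)² ≤ d(x,y)²`, which is almost firm
nonexpansiveness `d(Tx,y)² ≤ (1 + ε) d(x,y)² - K d(x,Tx)²`. This last property passes to
relaxations by the uniform convexity of `d(·,y)²`, and to compositions because
`min {K₀ s² + K₁ t² : s + t = u} = K₀ K₁ / (K₀ + K₁) u²`. Combined with
`d(x, Fix T ∩ D) ≤ μ d(x,Tx)` it makes `T` contract the distance to `Fix T ∩ D` by the factor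
`√(1 + ε - K / μ²)`. As the neighbourhood of the solution set shrinks, the constants tend to those
of the flat case, which gives the asymptotic rate.
-/

namespace ProxCAT

section Iteration

variable {G : Type*} [MetricSpace G] {T : G → G} {D S : Set G} {x y : G} {γ : ℝ}

lemma le_comp_infDist (hy : y ∈ S) {φ : ℝ → ℝ} (hφ : Continuous φ) {a : ℝ}
    (h : ∀ z ∈ S, dist z x ≤ dist y x → a ≤ φ (dist x z)) : a ≤ φ (Metric.infDist x S) := by
  set S' := S ∩ Metric.closedBall x (dist y x)
  have hne : (dist x '' S').Nonempty := ⟨_, mem_image_of_mem _ ⟨hy, Metric.mem_closedBall.2 le_rfl⟩⟩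
  have hmem : Metric.infDist x S ∈ closure (dist x '' S') := by
    rw [← Metric.infDist_inter_closedBall_of_mem hy, Metric.infDist_eq_iInf, ← sInf_image']
    exact csInf_mem_closure hne ⟨0, forall_mem_image.2 fun _ _ => dist_nonneg⟩
  have hsub : dist x '' S' ⊆ {t | a ≤ φ t} := forall_mem_image.2 fun z hz => h z hz.1 hz.2
  exact closure_minimal hsub (isClosed_le continuous_const hφ) hmem

lemma le_sqrt_mul_of_sq_le {a b t : ℝ} (hb : 0 ≤ b) (h : a ^ 2 ≤ t * b ^ 2) : a ≤ √t * b := by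
  rw [← Real.sqrt_sq hb, ← Real.sqrt_mul' _ (sq_nonneg b)]
  exact Real.le_sqrt_of_sq_le h

section Step

variable {x' : G} {ε K μ : ℝ}

lemma dist_le_mul_infDist (hy : y ∈ S) (hK : 0 ≤ K)
    (h : ∀ z ∈ S, dist z x ≤ dist y x →
      dist x' z ^ 2 ≤ (1 + ε) * dist x z ^ 2 - K * dist x x' ^ 2) :
    dist x x' ≤ (1 + √(1 + ε)) * Metric.infDist x S := by
  refine le_comp_infDist (φ := fun t => (1 + √(1 + ε)) * t) hy (by fun_prop) fun z hz hzx => ?_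
  have hsq : dist x' z ^ 2 ≤ (1 + ε) * dist x z ^ 2 := by
    have hdrop : 0 ≤ K * dist x x' ^ 2 := by positivity
    linarith [h z hz hzx]
  linarith [dist_triangle_right x x' z, le_sqrt_mul_of_sq_le dist_nonneg hsq]

lemma infDist_le_sqrt_mul_infDist (hy : y ∈ S) (hK : 0 ≤ K) (hμ : 0 < μ)
    (hreg : Metric.infDist x S ≤ μ * dist x x')
    (h : ∀ z ∈ S, dist z x ≤ dist y x →
      dist x' z ^ 2 ≤ (1 + ε) * dist x z ^ 2 - K * dist x x' ^ 2) :
    Metric.infDist x' S ≤ √(1 + ε - K / μ ^ 2) * Metric.infDist x S := by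
  have hdrop : K / μ ^ 2 * Metric.infDist x S ^ 2 ≤ K * dist x x' ^ 2 :=
    calc K / μ ^ 2 * Metric.infDist x S ^ 2 ≤ K / μ ^ 2 * (μ * dist x x') ^ 2 := by
          gcongr
          exact Metric.infDist_nonneg
      _ = K * dist x x' ^ 2 := by field_simp
  have hsq : Metric.infDist x' S ^ 2 ≤
      (1 + ε) * Metric.infDist x S ^ 2 - K / μ ^ 2 * Metric.infDist x S ^ 2 := by
    refine le_comp_infDist (φ := fun t => (1 + ε) * t ^ 2 - K / μ ^ 2 * Metric.infDist x S ^ 2) hy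
      (by fun_prop) fun z hz hzx => ?_
    have hle : Metric.infDist x' S ^ 2 ≤ dist x' z ^ 2 :=
      pow_le_pow_left₀ Metric.infDist_nonneg (Metric.infDist_le_dist_of_mem hz) 2
    linarith [h z hz hzx]
  exact le_sqrt_mul_of_sq_le Metric.infDist_nonneg (by rwa [sub_mul])

end Step

lemma ConvergesLinearly.of_contracting [CompleteSpace G] {E : Set G} (hE : IsClosed E)
    (hED : E ⊆ D) (hmaps : MapsTo T E E) (hγ₀ : 0 ≤ γ) (hγ₁ : γ < 1) {M : ℝ} (hM : 0 ≤ M)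
    (hdist : ∀ x ∈ E, dist x (T x) ≤ M * Metric.infDist x (Function.fixedPoints T ∩ D))
    (hcontr : ∀ x ∈ E, Metric.infDist (T x) (Function.fixedPoints T ∩ D) ≤
      γ * Metric.infDist x (Function.fixedPoints T ∩ D)) (hx : x ∈ E) :
    ConvergesLinearly T D γ (M / (1 - γ)) x := by
  set S := Function.fixedPoints T ∩ D
  have hmem (k : ℕ) : T^[k] x ∈ E := hmaps.iterate k hx
  have hstep (k : ℕ) : Metric.infDist (T^[k + 1] x) S ≤ γ * Metric.infDist (T^[k] x) S := by
    rw [Function.iterate_succ_apply']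
    exact hcontr _ (hmem k)
  have hgeom (k : ℕ) : Metric.infDist (T^[k] x) S ≤ γ ^ k * Metric.infDist x S :=
    le_geom (u := fun k => Metric.infDist (T^[k] x) S) hγ₀ k fun j _ => hstep j
  have hsucc (k : ℕ) : dist (T^[k] x) (T^[k + 1] x) ≤ M * Metric.infDist x S * γ ^ k := by
    rw [Function.iterate_succ_apply', mul_right_comm, mul_assoc]
    exact (hdist _ (hmem k)).trans (by gcongr; linarith [hgeom k])
  obtain ⟨x', hx'⟩ := cauchySeq_tendsto_of_complete (cauchySeq_of_le_geometric _ _ hγ₁ hsucc)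
  have hx'E : x' ∈ E := hE.mem_of_tendsto hx' (Eventually.of_forall hmem)
  have hzero : Metric.infDist x' S = 0 := by
    have hlim : Tendsto (fun k => γ ^ k * Metric.infDist x S) atTop (𝓝 0) := by
      simpa using (tendsto_pow_atTop_nhds_zero_of_lt_one hγ₀ hγ₁).mul_const (Metric.infDist x S)
    exact le_antisymm (le_of_tendsto_of_tendsto'
      (((Metric.continuous_infDist_pt S).tendsto x').comp hx') hlim hgeom) Metric.infDist_nonneg
  have hfix : T x' = x' := by
    have hle := hdist x' hx'E
    rw [hzero, mul_zero] at hle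
    exact (dist_le_zero.1 hle).symm
  refine ⟨x', ⟨hfix, hED hx'E⟩, fun k => ⟨hstep k, ?_⟩⟩
  exact (dist_le_of_le_geometric_of_tendsto _ _ hγ₁ hsucc hx' k).trans_eq (by ring)

lemma ConvergesLinearly.exists_tendsto {a : ℝ} (hγ₀ : 0 ≤ γ) (hγ₁ : γ < 1)
    (h : ConvergesLinearly T D γ a x) :
    ∃ x' ∈ Function.fixedPoints T ∩ D, Tendsto (fun k => T^[k] x) atTop (𝓝 x') ∧ ∀ k : ℕ,
      Metric.infDist (T^[k + 1] x) (Function.fixedPoints T ∩ D) ≤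
        γ * Metric.infDist (T^[k] x) (Function.fixedPoints T ∩ D) ∧
      dist (T^[k] x) x' ≤ a * γ ^ k * Metric.infDist x (Function.fixedPoints T ∩ D) := by
  obtain ⟨x', hx', hk⟩ := h
  refine ⟨x', hx', tendsto_iff_dist_tendsto_zero.2
    (squeeze_zero (fun _ => dist_nonneg) (fun k => (hk k).2) ?_), hk⟩
  simpa using ((tendsto_pow_atTop_nhds_zero_of_lt_one hγ₀ hγ₁).const_mul a).mul_const
    (Metric.infDist x (Function.fixedPoints T ∩ D))

lemma exists_rate_of_linearNear {x' : G} {ρ : ℝ} (hT : MapsTo T D D) (hx : x ∈ D)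
    (hlim : Tendsto (fun k => T^[k] x) atTop (𝓝 x')) (hγ₀ : 0 ≤ γ) (hγ₁ : γ < 1) (hγρ : γ < ρ)
    (hlin : LinearNear T D {x'} γ) :
    (∀ᶠ k : ℕ in atTop, Metric.infDist (T^[k + 1] x) (Function.fixedPoints T ∩ D) ≤
      ρ * Metric.infDist (T^[k] x) (Function.fixedPoints T ∩ D)) ∧
    ∃ a : ℝ, ∀ k : ℕ, dist (T^[k] x) x' ≤ a * ρ ^ k := by
  set S := Function.fixedPoints T ∩ D
  have hρ : 0 < ρ := hγ₀.trans_lt hγρ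
  obtain ⟨δ, hδ, a, ha, hlin⟩ := hlin
  obtain ⟨k₀, hk₀⟩ := ((tendsto_iff_dist_tendsto_zero.1 hlim).eventually_lt_const hδ).exists
  obtain ⟨x'', -, hlim', htail⟩ :=
    (hlin x' rfl _ (hT.iterate k₀ hx) hk₀).exists_tendsto hγ₀ hγ₁
  simp only [← Function.iterate_add_apply] at hlim' htail
  obtain rfl : x'' = x' := tendsto_nhds_unique hlim' (hlim.comp (tendsto_add_atTop_nat k₀))
  constructor
  · filter_upwards [eventually_ge_atTop k₀] with k hk
    obtain ⟨j, rfl⟩ := Nat.exists_eq_add_of_le' hk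
    rw [add_right_comm]
    exact (htail j).1.trans (mul_le_mul_of_nonneg_right hγρ.le Metric.infDist_nonneg)
  · have hO : (fun k => dist (T^[k] x) x'') =O[atTop] fun k => ρ ^ k := by
      refine Asymptotics.IsBigO.of_bound (a * Metric.infDist (T^[k₀] x) S / ρ ^ k₀) ?_
      filter_upwards [eventually_ge_atTop k₀] with k hk
      obtain ⟨j, rfl⟩ := Nat.exists_eq_add_of_le' hk
      rw [Real.norm_of_nonneg dist_nonneg, Real.norm_of_nonneg (by positivity)]
      calc dist (T^[j + k₀] x) x'' ≤ a * γ ^ j * Metric.infDist (T^[k₀] x) S := (htail j).2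
        _ ≤ a * ρ ^ j * Metric.infDist (T^[k₀] x) S := by
          gcongr
          exact Metric.infDist_nonneg
        _ = a * Metric.infDist (T^[k₀] x) S / ρ ^ k₀ * ρ ^ (j + k₀) := by
          rw [pow_add]
          field_simp
    obtain ⟨b, -, hb⟩ := Asymptotics.bound_of_isBigO_nat_atTop hO
    refine ⟨b, fun k => ?_⟩
    have hbk := hb (x := k) (by positivity)
    rwa [Real.norm_of_nonneg dist_nonneg, Real.norm_of_nonneg (by positivity)] at hbk

lemma exists_convergesAsymptotically {γ' r : ℝ} (hT : MapsTo T D D)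
    (hS : S ⊆ Function.fixedPoints T ∩ D) (hγ₀ : 0 ≤ γ) (hγ₁ : γ < 1) (hlin : LinearNear T D S γ)
    (hr : 0 < r) (h : ∀ y ∈ S, ∀ z ∈ Function.fixedPoints T ∩ D, dist z y < r → ∀ ρ > γ',
      ∃ γ < ρ, 0 ≤ γ ∧ γ < 1 ∧ LinearNear T D {z} γ) :
    ∃ δ > 0, ∀ y ∈ S, ∀ x ∈ D, dist x y < δ → ConvergesAsymptotically T D γ' x := by
  obtain ⟨δ, hδ, a, ha, hlin⟩ := hlin
  refine ⟨min δ (r / (a + 1)), by positivity, fun y hy x hx hxy => ?_⟩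
  obtain ⟨hxδ, hxr⟩ := lt_min_iff.1 hxy
  obtain ⟨x', hx', hlim, hk⟩ := (hlin y hy x hx hxδ).exists_tendsto hγ₀ hγ₁
  have hx'y : dist x' y < r := by
    have hxx' : dist x x' ≤ a * dist x y := by
      simpa using (hk 0).2.trans (mul_le_mul_of_nonneg_left
        (Metric.infDist_le_dist_of_mem (hS hy)) (by positivity))
    rw [lt_div_iff₀' (by positivity)] at hxr
    linarith [dist_triangle_left x' y x]
  refine ⟨x', hx', hlim, fun ρ hρ => ?_⟩
  obtain ⟨γ, hγρ, hγ₀, hγ₁, hlin'⟩ := h y hy x' hx' hx'y ρ hρ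
  exact exists_rate_of_linearNear hT hx hlim hγ₀ hγ₁ hγρ hlin'

end Iteration

section SetValued

variable {G : Type*} [MetricSpace G] {F F₀ F₁ : G → Set G} {Ω Ω₀ Ω₁ Z S : Set G} {y : G}
  {r ε ε₀ ε₁ K K₀ K₁ : ℝ}

/-- The composition `F₁ ∘ F₀` of set-valued mappings. -/
def composition (F₁ F₀ : G → Set G) (x : G) : Set G := {w | ∃ m ∈ F₀ x, w ∈ F₁ m}

/-- The relaxation `β F ⊕ (1 - β) Id` of a set-valued mapping. -/
def relaxation (β : ℝ) (F : G → Set G) (x : G) : Set G := {m | ∃ q ∈ F x, m ∈ combo β x q}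

lemma mem_composition_relaxation {β : ℝ} {x w : G} : w ∈ composition F₁ (relaxation β F₀) x ↔
    ∃ q ∈ F₀ x, ∃ m ∈ combo β x q, w ∈ F₁ m := by
  simp only [composition, relaxation, mem_ofPred_eq]
  tauto

/-- The single-valued mapping `T` on `D` as a set-valued mapping, empty outside `D`. -/
def restriction (T : G → G) (D : Set G) (x : G) : Set G := {m | x ∈ D ∧ m = T x}

/-- Within distance `r` of `y`, the set-valued mapping `F` does not increase the distance to `y`,
its fixed points belong to `Ω`, and `F` is the identity on `Ω`. -/
structure QuasiNonexpansiveAt (F : G → Set G) (Ω : Set G) (y : G) (r : ℝ) : Prop where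
  mem_of_mem_self : ∀ x, x ∈ F x → dist x y < r → x ∈ Ω
  eq_of_mem : ∀ x ∈ Ω, ∀ m ∈ F x, dist x y < r → m = x
  dist_le : ∀ x, ∀ m ∈ F x, dist x y < r → dist m y ≤ dist x y

/-- A quasi nonexpansive mapping that strictly decreases the distance to `y` of the points
it moves. -/
structure StrictlyQuasiNonexpansiveAt (F : G → Set G) (Ω : Set G) (y : G) (r : ℝ) : Prop
    extends QuasiNonexpansiveAt F Ω y r where
  eq_of_dist_le : ∀ x, ∀ m ∈ F x, dist x y < r → dist x y ≤ dist m y → m = x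

/-- Almost firm nonexpansiveness of the set-valued mapping `F` at the points of `Z`, with
violation `ε` and with `K` the coefficient of the transport discrepancy, on neighbourhoods of the
points of `S` of a common radius. -/
def AlmostFirmNear (F : G → Set G) (Z S : Set G) (ε K : ℝ) : Prop :=
  ∃ r > 0, ∀ y ∈ S, ∀ x, ∀ m ∈ F x, ∀ z ∈ Z, dist x y < r → dist z y < r →
    dist m z ^ 2 ≤ (1 + ε) * dist x z ^ 2 - K * dist x m ^ 2

lemma StrictlyQuasiNonexpansiveAt.mono {r' : ℝ} (h : StrictlyQuasiNonexpansiveAt F Ω y r)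
    (hr : r' ≤ r) : StrictlyQuasiNonexpansiveAt F Ω y r' where
  mem_of_mem_self x hx hxy := h.mem_of_mem_self x hx (hxy.trans_le hr)
  eq_of_mem x hx m hm hxy := h.eq_of_mem x hx m hm (hxy.trans_le hr)
  dist_le x m hm hxy := h.dist_le x m hm (hxy.trans_le hr)
  eq_of_dist_le x m hm hxy := h.eq_of_dist_le x m hm (hxy.trans_le hr)

lemma StrictlyQuasiNonexpansiveAt.comp (h₁ : StrictlyQuasiNonexpansiveAt F₁ Ω₁ y r)
    (h₀ : QuasiNonexpansiveAt F₀ Ω₀ y r) :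
    QuasiNonexpansiveAt (composition F₁ F₀) (Ω₁ ∩ Ω₀) y r where
  mem_of_mem_self x := by
    rintro ⟨m, hm, hx⟩ hxy
    have hmy := h₀.dist_le x m hm hxy
    obtain rfl : x = m := h₁.eq_of_dist_le m x hx (hmy.trans_lt hxy) hmy
    exact ⟨h₁.mem_of_mem_self x hx hxy, h₀.mem_of_mem_self x hm hxy⟩
  eq_of_mem x hxΩ w := by
    rintro ⟨m, hm, hw⟩ hxy
    obtain rfl := h₀.eq_of_mem x hxΩ.2 m hm hxy
    exact h₁.eq_of_mem m hxΩ.1 w hw hxy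
  dist_le x w := by
    rintro ⟨m, hm, hw⟩ hxy
    have hmy := h₀.dist_le x m hm hxy
    exact (h₁.dist_le m w hw (hmy.trans_lt hxy)).trans hmy

section Selection

variable {T : G → G} {D : Set G} {x : G}

lemma QuasiNonexpansiveAt.mem_of_eq (h : QuasiNonexpansiveAt F Ω y r) (hx : T x ∈ F x)
    (hxy : dist x y < r) (hfix : T x = x) : x ∈ Ω :=
  h.mem_of_mem_self x (by rwa [hfix] at hx) hxy

lemma FixedPointsAre.of_quasiNonexpansiveAt {κ : ℝ} (hsel : ∀ x ∈ D, T x ∈ F x)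
    (h : ∀ y ∈ Ω, QuasiNonexpansiveAt F Ω y (Real.pi / (2 * √κ))) : FixedPointsAre κ T D Ω :=
  fun x hx y hy hxy => ⟨(h y hy).mem_of_eq (hsel x hx) hxy,
    fun hxΩ => (h y hy).eq_of_mem x hxΩ _ (hsel x hx) hxy⟩

lemma QuasiNonexpansiveAt.mem_fixedPoints (h : QuasiNonexpansiveAt F Ω y r) (hr : 0 < r)
    (hsel : ∀ x ∈ D, T x ∈ F x) (hy : y ∈ Ω ∩ D) : y ∈ Function.fixedPoints T ∩ D :=
  ⟨h.eq_of_mem y hy.1 _ (hsel y hy.2) (by rwa [dist_self]), hy.2⟩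

end Selection

lemma AlmostFirmNear.of_dist_lt (hr : 0 < r) (h : ∀ x, ∀ m ∈ F x, ∀ z ∈ Z, dist x z < r →
    dist m z ^ 2 ≤ (1 + ε) * dist x z ^ 2 - K * dist x m ^ 2) : AlmostFirmNear F Z S ε K :=
  ⟨r / 2, half_pos hr, fun y _ x m hm z hz hxy hzy =>
    h x m hm z hz (by linarith [dist_triangle_right x z y])⟩

lemma AlmostFirmNear.mono {Z' S' : Set G} {K' : ℝ} (h : AlmostFirmNear F Z S ε K) (hZ : Z' ⊆ Z)
    (hS : S' ⊆ S) (hK : K' ≤ K) : AlmostFirmNear F Z' S' ε K' := by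
  obtain ⟨r, hr, h⟩ := h
  refine ⟨r, hr, fun y hy x m hm z hz hxy hzy => (h y (hS hy) x m hm z (hZ hz) hxy hzy).trans ?_⟩
  gcongr

lemma AlmostFirmNear.change_coeff {ε' K' : ℝ} (h : AlmostFirmNear F Z S ε K) (hK : 0 ≤ K)
    (hε : ε + |K' - K| * (4 + 2 * ε) ≤ ε') : AlmostFirmNear F Z S ε' K' := by
  obtain ⟨r, hr, h⟩ := h
  refine ⟨r, hr, fun y hy x m hm z hz hxy hzy => ?_⟩
  have hfirm := h y hy x m hm z hz hxy hzy
  have hstep : dist x m ^ 2 ≤ (4 + 2 * ε) * dist x z ^ 2 := by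
    have htri : dist x m ^ 2 ≤ (dist x z + dist m z) ^ 2 := by
      gcongr
      exact dist_triangle_right _ _ _
    have hdrop : 0 ≤ K * dist x m ^ 2 := by positivity
    nlinarith [sq_nonneg (dist x z - dist m z)]
  have hdiff : (K' - K) * dist x m ^ 2 ≤ |K' - K| * ((4 + 2 * ε) * dist x z ^ 2) :=
    (mul_le_mul_of_nonneg_right (le_abs_self _) (sq_nonneg _)).trans
      (mul_le_mul_of_nonneg_left hstep (abs_nonneg _))
  linarith [mul_le_mul_of_nonneg_right hε (sq_nonneg (dist x z))]

lemma parallel_mul_add_sq_le {a b : ℝ} (ha : 0 < a) (hb : 0 < b) (s t : ℝ) :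
    a * b / (a + b) * (s + t) ^ 2 ≤ a * s ^ 2 + b * t ^ 2 := by
  rw [div_mul_eq_mul_div, div_le_iff₀ (by positivity)]
  linarith [sq_nonneg (a * s - b * t)]

lemma AlmostFirmNear.comp (h₁ : AlmostFirmNear F₁ Z S ε₁ K₁) (h₀ : AlmostFirmNear F₀ Z S ε₀ K₀)
    (hr : 0 < r) (hq : ∀ y ∈ S, QuasiNonexpansiveAt F₀ Ω y r) (hε₁ : 0 ≤ ε₁) (hK₀ : 0 < K₀)
    (hK₁ : 0 < K₁) :
    AlmostFirmNear (composition F₁ F₀) Z S (ε₀ + ε₁ + ε₀ * ε₁) (K₀ * K₁ / (K₀ + K₁)) := by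
  obtain ⟨r₀, hr₀, h₀⟩ := h₀
  obtain ⟨r₁, hr₁, h₁⟩ := h₁
  refine ⟨min r (min r₀ r₁), by positivity, fun y hy x w hw z hz hxy hzy => ?_⟩
  obtain ⟨m, hm, hw⟩ := hw
  obtain ⟨hxr, hxr₀, hxr₁⟩ := by simpa only [lt_min_iff] using hxy
  obtain ⟨-, hzr₀, hzr₁⟩ := by simpa only [lt_min_iff] using hzy
  have hmy := ((hq y hy).dist_le x m hm hxr).trans_lt hxr₁
  have hfirm₀ := h₀ y hy x m hm z hz hxr₀ hzr₀
  have hfirm₁ := h₁ y hy m w hw z hz hmy hzr₁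
  have hxw : K₀ * K₁ / (K₀ + K₁) * dist x w ^ 2 ≤ K₀ * dist x m ^ 2 + K₁ * dist m w ^ 2 :=
    calc _ ≤ K₀ * K₁ / (K₀ + K₁) * (dist x m + dist m w) ^ 2 := by
          gcongr
          exact dist_triangle _ _ _
      _ ≤ _ := parallel_mul_add_sq_le hK₀ hK₁ _ _
  have hscaled := mul_le_mul_of_nonneg_left hfirm₀ (by linarith : 0 ≤ 1 + ε₁)
  have hcross : 0 ≤ ε₁ * (K₀ * dist x m ^ 2) := by positivity
  linarith

lemma QuasiNonexpansiveAt.restriction {T : G → G} {D : Set G}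
    (h : ∀ x ∈ D, dist x y < r → dist (T x) y ≤ dist x y) :
    QuasiNonexpansiveAt (restriction T D) (Function.fixedPoints T) y r where
  mem_of_mem_self _ hx _ := hx.2.symm
  eq_of_mem _ hx _ hm _ := hm.2.trans hx
  dist_le := by
    rintro x _ ⟨hx, rfl⟩ hxy
    exact h x hx hxy

lemma IsLocallyQuasiNonexpansive.exists_quasiNonexpansiveAt_restriction {T₀ : G → G} {D : Set G}
    (h : IsLocallyQuasiNonexpansive T₀ D S) (hS : S ⊆ Function.fixedPoints T₀) (hy : y ∈ S) {R : ℝ}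
    (hR : 0 < R) :
    ∃ r ∈ Ioc 0 R, QuasiNonexpansiveAt (restriction T₀ D) (Function.fixedPoints T₀) y r := by
  obtain ⟨r, hr, hle⟩ := h y hy
  rw [hS hy] at hle
  exact ⟨min r R, ⟨lt_min hr hR, min_le_right _ _⟩,
    .restriction fun x hx hxy => hle x hx (hxy.trans_le (min_le_left _ _))⟩

lemma psi_two_eq {T : G → G} {x z : G} (hz : T z = z) : psi 2 T x z = dist x (T x) ^ 2 := by
  rw [psi, hz, dist_self, dist_comm (T x) x]
  ring

lemma AlmostFirmNear.restriction {T : G → G} {D : Set G} {α : ℝ}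
    (h : IsAsymptoticallyFirm T D S α) (hS : S ⊆ Function.fixedPoints T) (hy : y ∈ S)
    (hε : 0 < ε) : AlmostFirmNear (restriction T D) S {y} ε ((1 - α) / α) := by
  obtain ⟨r, hr, h⟩ := h y hy ε hε
  refine ⟨r, hr, ?_⟩
  rintro _ rfl x _ ⟨hx, rfl⟩ z hz hxy hzy
  have hfirm := h x hx z hz hxy hzy
  rwa [psi_two_eq (hS hz), hS hz] at hfirm

end SetValued

section LinearConvergence

variable {G : Type*} [MetricSpace G] {T : G → G} {F : G → Set G} {D Ω S : Set G} {ε K μ : ℝ}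

/-- A self-mapping `T` of the closed set `D` that is linearly metrically subregular there with
constant `μ`. -/
structure IsSubregularSelfMap (T : G → G) (D : Set G) (μ : ℝ) : Prop where
  isClosed : IsClosed D
  mapsTo : MapsTo T D D
  pos : 0 < μ
  infDist_le : ∀ x ∈ D, Metric.infDist x (Function.fixedPoints T ∩ D) ≤ μ * dist x (T x)

variable [CompleteSpace G] (hT : IsSubregularSelfMap T D μ) (hsel : ∀ x ∈ D, T x ∈ F x)
  (hS : S ⊆ Ω ∩ D)
include hT hsel hS

lemma linearNear_of_almostFirmNear {r : ℝ} (hr : 0 < r)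
    (hq : ∀ y ∈ S, QuasiNonexpansiveAt F Ω y r) (hfirm : AlmostFirmNear F (Ω ∩ D) S ε K)
    (hK : 0 ≤ K) (hγ : √(1 + ε - K / μ ^ 2) < 1) : LinearNear T D S √(1 + ε - K / μ ^ 2) := by
  obtain ⟨r', hr', hfirm⟩ := hfirm
  refine ⟨min r r' / 2, by positivity, _,
    div_pos (by positivity : 0 < 1 + √(1 + ε)) (sub_pos.2 hγ), fun y hy x hx hxy => ?_⟩
  have hyfix := (hq y hy).mem_fixedPoints hr hsel (hS hy)
  have hstep : ∀ x' ∈ D ∩ Metric.closedBall y (dist x y), ∀ z ∈ Function.fixedPoints T ∩ D,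
      dist z x' ≤ dist y x' →
      dist (T x') z ^ 2 ≤ (1 + ε) * dist x' z ^ 2 - K * dist x' (T x') ^ 2 := by
    intro x' hx' z hz hzx'
    have hx'y : dist x' y ≤ dist x y := hx'.2
    have hzy : dist z y < min r r' := by
      rw [dist_comm y x'] at hzx'
      linarith [dist_triangle z x' y]
    have hzΩ := (hq y hy).mem_of_eq (hsel z hz.2) (hzy.trans_le (min_le_left _ _)) hz.1
    exact hfirm y hy x' _ (hsel x' hx'.1) z ⟨hzΩ, hz.2⟩
      (by linarith [min_le_right r r', dist_nonneg (x := x) (y := y)])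
      (hzy.trans_le (min_le_right _ _))
  refine .of_contracting (hT.isClosed.inter Metric.isClosed_closedBall) inter_subset_left
    (fun x' hx' => ⟨hT.mapsTo hx'.1, ?_⟩) (Real.sqrt_nonneg _) hγ (by positivity)
    (fun x' hx' => dist_le_mul_infDist hyfix hK (hstep x' hx'))
    (fun x' hx' => infDist_le_sqrt_mul_infDist hyfix hK hT.pos (hT.infDist_le x' hx'.1)
      (hstep x' hx')) ⟨hx, Metric.mem_closedBall.2 le_rfl⟩
  have hx'y : dist x' y ≤ dist x y := hx'.2
  exact ((hq y hy).dist_le x' _ (hsel x' hx'.1)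
    (by linarith [min_le_left r r', dist_nonneg (x := x) (y := y)])).trans hx'y

lemma exists_convergesAsymptotically_of_almostFirmNear {r : ℝ} (hr : 0 < r)
    (hq : ∀ y ∈ S, QuasiNonexpansiveAt F Ω y r)
    (hfirm : ∀ ε > 0, AlmostFirmNear F (Ω ∩ D) S ε K)
    (hq' : ∀ z ∈ Ω ∩ D, ∃ r > 0, QuasiNonexpansiveAt F Ω z r)
    (hfirm' : ∀ z ∈ Ω ∩ D, ∀ ε > 0, AlmostFirmNear F (Ω ∩ D) {z} ε K) (hK : 0 < K) :
    ∃ δ > 0, ∀ y ∈ S, ∀ x ∈ D, dist x y < δ →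
      ConvergesAsymptotically T D √(1 - K / μ ^ 2) x := by
  have hlt : √(1 - K / μ ^ 2) < 1 := by
    rw [Real.sqrt_lt' one_pos]
    linarith [div_pos hK (pow_pos hT.pos 2)]
  have hrate : ∀ ρ > √(1 - K / μ ^ 2), ∃ ε > 0, √(1 + ε - K / μ ^ 2) < ρ := by
    intro ρ hρ
    have hlim : Tendsto (fun ε : ℝ => √(1 + ε - K / μ ^ 2)) (𝓝[>] 0) (𝓝 √(1 + 0 - K / μ ^ 2)) :=
      (Continuous.tendsto (by fun_prop) _).mono_left nhdsWithin_le_nhds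
    rw [add_zero] at hlim
    exact ((hlim.eventually_lt_const hρ).and self_mem_nhdsWithin).exists.imp fun _ h => h.symm
  obtain ⟨ε, hε, hγ⟩ := hrate 1 hlt
  refine exists_convergesAsymptotically hT.mapsTo
    (fun y hy => (hq y hy).mem_fixedPoints hr hsel (hS hy)) (Real.sqrt_nonneg _) hγ
    (linearNear_of_almostFirmNear hT hsel hS hr hq (hfirm ε hε) hK.le hγ) hr
    fun y hy z hz hzy ρ hρ => ?_
  have hzΩ : z ∈ Ω ∩ D := ⟨(hq y hy).mem_of_eq (hsel z hz.2) hzy hz.1, hz.2⟩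
  obtain ⟨ε', hε', hγ'⟩ := hrate (min ρ 1) (lt_min hρ hlt)
  obtain ⟨s, hs, hqz⟩ := hq' z hzΩ
  exact ⟨_, hγ'.trans_le (min_le_left _ _), Real.sqrt_nonneg _, hγ'.trans_le (min_le_right _ _),
    linearNear_of_almostFirmNear hT hsel (singleton_subset_iff.2 hzΩ) hs
      (forall_eq.2 hqz) (hfirm' z hzΩ ε' hε') hK.le (hγ'.trans_le (min_le_right _ _))⟩

end LinearConvergence

section Constants

/-- The coefficient of `d(x,Tx)²` in the inequality of (almost) firm nonexpansiveness with
constant `α` at a fixed point of `T`. -/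
noncomputable def firmCoeff (c α : ℝ) : ℝ := c / 2 * ((1 - α) / α)

variable {c α β a₀ a₁ : ℝ}

lemma rate_eq (c α ε μ : ℝ) : rate c α ε μ = √(1 + ε - firmCoeff c α / μ ^ 2) := by
  rw [rate, firmCoeff, ← div_div, mul_div_assoc]

lemma firmCoeff_pos (hc : 0 < c) (hα : α ∈ Ioo (0 : ℝ) 1) : 0 < firmCoeff c α :=
  mul_pos (by positivity) (div_pos (sub_pos.2 hα.2) hα.1)

lemma firmCoeff_le_of_le_two (hc : c ≤ 2) (hα : α ∈ Ioo (0 : ℝ) 1) :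
    firmCoeff c α ≤ (1 - α) / α :=
  mul_le_of_le_one_left (div_pos (sub_pos.2 hα.2) hα.1).le (by linarith)

lemma rate_lt_one {μ : ℝ} (hc : 0 < c) (hα : α ∈ Ioo (0 : ℝ) 1) (hμ : 0 < μ) :
    rate c α 0 μ < 1 := by
  rw [rate_eq, Real.sqrt_lt' one_pos]
  linarith [div_pos (firmCoeff_pos hc hα) (pow_pos hμ 2)]

lemma alphaComp_eq (c a₀ a₁ : ℝ) :
    alphaComp c a₀ a₁ = (a₀ * (1 - a₁) + a₁ * (1 - a₀)) /
      (c / 2 * ((1 - a₀) * (1 - a₁)) + (a₀ * (1 - a₁) + a₁ * (1 - a₀))) := by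
  rw [alphaComp]
  congr 1 <;> ring

lemma alphaComp_mem (hc : 0 < c) (h₀ : a₀ ∈ Ioo (0 : ℝ) 1) (h₁ : a₁ ∈ Ioo (0 : ℝ) 1) :
    alphaComp c a₀ a₁ ∈ Ioo (0 : ℝ) 1 := by
  have h₀' := sub_pos.2 h₀.2
  have h₁' := sub_pos.2 h₁.2
  have hN : 0 < a₀ * (1 - a₁) + a₁ * (1 - a₀) := add_pos (mul_pos h₀.1 h₁') (mul_pos h₁.1 h₀')
  have hM : 0 < c / 2 * ((1 - a₀) * (1 - a₁)) := by positivity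
  rw [alphaComp_eq]
  exact ⟨by positivity, (div_lt_one (by positivity)).2 (by linarith)⟩

lemma firmCoeff_alphaComp (hc : 0 < c) (h₀ : a₀ ∈ Ioo (0 : ℝ) 1) (h₁ : a₁ ∈ Ioo (0 : ℝ) 1) :
    firmCoeff c (alphaComp c a₀ a₁) =
      c / 2 * (firmCoeff c a₀ * firmCoeff c a₁ / (firmCoeff c a₀ + firmCoeff c a₁)) := by
  have h₀' := sub_pos.2 h₀.2
  have h₁' := sub_pos.2 h₁.2
  have hN : 0 < a₀ * (1 - a₁) + a₁ * (1 - a₀) := add_pos (mul_pos h₀.1 h₁') (mul_pos h₁.1 h₀')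
  have hM : 0 < c / 2 * ((1 - a₀) * (1 - a₁)) := by positivity
  have hcomp : (1 - alphaComp c a₀ a₁) / alphaComp c a₀ a₁ =
      c / 2 * ((1 - a₀) * (1 - a₁)) / (a₀ * (1 - a₁) + a₁ * (1 - a₀)) := by
    rw [alphaComp_eq]
    field_simp
    ring
  have := h₀.1
  have := h₁.1
  simp only [firmCoeff, hcomp]
  generalize 1 - a₀ = b₀ at *
  generalize 1 - a₁ = b₁ at *
  field_simp
  ring

lemma firmCoeff_alphaComp_le (hc : c ∈ Ioc (0 : ℝ) 2) (h₀ : a₀ ∈ Ioo (0 : ℝ) 1)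
    (h₁ : a₁ ∈ Ioo (0 : ℝ) 1) : firmCoeff c (alphaComp c a₀ a₁) ≤
      firmCoeff c a₀ * firmCoeff c a₁ / (firmCoeff c a₀ + firmCoeff c a₁) := by
  have := firmCoeff_pos hc.1 h₀
  have := firmCoeff_pos hc.1 h₁
  rw [firmCoeff_alphaComp hc.1 h₀ h₁]
  exact mul_le_of_le_one_left (by positivity) (by linarith [hc.2])

lemma alphaComp_half (c a : ℝ) : alphaComp c a (1 / 2) = 1 / (c / 2 * (1 - a) + 1) := by
  rw [alphaComp_eq, show a * (1 - 1 / 2) + 1 / 2 * (1 - a) = (1 / 2 : ℝ) by ring,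
    show c / 2 * ((1 - a) * (1 - 1 / 2)) + 1 / 2 = 1 / 2 * (c / 2 * (1 - a) + 1) by ring, ← div_div]
  norm_num

lemma firmCoeff_half (c : ℝ) : firmCoeff c (1 / 2) = c / 2 := by
  norm_num [firmCoeff]

lemma alphaProx_mem (hc : 1 < c) : alphaProx c ∈ Ioo (0 : ℝ) 1 := by
  have h : 0 < c * (c - 1) := mul_pos (by linarith) (sub_pos.2 hc)
  exact ⟨div_pos h (by linarith), (div_lt_one (by linarith)).2 (by linarith)⟩

lemma alphaProx_mul_mem (hc : 1 < c) (hβ : β ∈ Ioc (0 : ℝ) 1) :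
    alphaProx c * β ∈ Ioo (0 : ℝ) 1 :=
  have h := alphaProx_mem hc
  ⟨mul_pos h.1 hβ.1, mul_lt_one_of_nonneg_of_lt_one_left h.1.le h.2 hβ.2⟩

lemma firmCoeff_alphaProx (hc : 1 < c) : firmCoeff c (alphaProx c) = 1 / (c - 1) := by
  have h := sub_pos.2 hc
  have := zero_lt_one.trans hc
  rw [firmCoeff, alphaProx]
  field_simp
  ring

lemma firmCoeff_mul_sq (hα : α ≠ 0) (hβ : β ≠ 0) :
    firmCoeff c (α * β) * β ^ 2 = β * firmCoeff c α + c / 2 * (β * (1 - β)) := by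
  rw [firmCoeff, firmCoeff]
  field_simp
  ring

lemma alphaComp_alphaProx (hc : 1 < c) :
    alphaComp c (alphaProx c) (alphaProx c) = 2 * (c - 1) / (2 * c - 1) := by
  have := sub_pos.2 hc
  have := zero_lt_one.trans hc
  have hcompl : 1 - alphaProx c = 2 / (c * (c - 1) + 2) := by
    rw [alphaProx]
    field_simp
    ring
  rw [alphaComp_eq, hcompl, alphaProx, div_eq_div_iff (by positivity) (by linarith)]
  field_simp
  ring

lemma epsProx_nonneg (hc : c ∈ Ioc (1 : ℝ) 2) : 0 ≤ epsProx c :=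
  div_nonneg (sub_nonneg.2 hc.2) (sub_nonneg.2 hc.1.le)

lemma one_add_epsProx (hc : 1 < c) : 1 + epsProx c = 1 / (c - 1) := by
  have := sub_pos.2 hc
  rw [epsProx]
  field_simp
  ring

section Limits

variable {ι : Type*} {l : Filter ι} {c α α₀ α₁ ε : ι → ℝ} {a : ℝ}

lemma tendsto_firmCoeff (ha : a ≠ 0) (hc : Tendsto c l (𝓝 2)) (hα : Tendsto α l (𝓝 a)) :
    Tendsto (fun i => firmCoeff (c i) (α i)) l (𝓝 (firmCoeff 2 a)) :=
  (hc.div_const 2).mul ((tendsto_const_nhds.sub hα).div hα ha)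

lemma tendsto_rate (μ : ℝ) (ha : a ≠ 0) (hc : Tendsto c l (𝓝 2)) (hα : Tendsto α l (𝓝 a))
    (hε : Tendsto ε l (𝓝 0)) :
    Tendsto (fun i => rate (c i) (α i) (ε i) μ) l (𝓝 (rate 2 a 0 μ)) := by
  simp only [rate_eq]
  exact ((tendsto_const_nhds.add hε).sub ((tendsto_firmCoeff ha hc hα).div_const _)).sqrt

lemma tendsto_alphaComp (ha : a < 1) (hc : Tendsto c l (𝓝 2)) (h₀ : Tendsto α₀ l (𝓝 a))
    (h₁ : Tendsto α₁ l (𝓝 (1 / 2))) :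
    Tendsto (fun i => alphaComp (c i) (α₀ i) (α₁ i)) l (𝓝 (1 / (2 - a))) := by
  have hN := (h₀.mul (h₁.const_sub 1)).add (h₁.mul (h₀.const_sub 1))
  have hM := (hc.div_const 2).mul ((h₀.const_sub 1).mul (h₁.const_sub 1))
  rw [show 1 / (2 - a) = alphaComp 2 a (1 / 2) by rw [alphaComp_half]; ring_nf]
  simp only [alphaComp_eq]
  exact hN.div (hM.add hN) (by linarith)

lemma tendsto_alphaProx (hc : Tendsto c l (𝓝 2)) :
    Tendsto (fun i => alphaProx (c i)) l (𝓝 (1 / 2)) := by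
  have hcont : ContinuousAt alphaProx 2 := by
    unfold alphaProx
    fun_prop (disch := norm_num)
  rw [show (1 / 2 : ℝ) = alphaProx 2 by norm_num [alphaProx]]
  exact hcont.tendsto.comp hc

lemma tendsto_alphaProx_mul (β : ℝ) (hc : Tendsto c l (𝓝 2)) :
    Tendsto (fun i => alphaProx (c i) * β) l (𝓝 (β / 2)) := by
  simpa only [one_div_mul_eq_div] using (tendsto_alphaProx hc).mul_const β

lemma tendsto_epsProx (hc : Tendsto c l (𝓝 2)) : Tendsto (fun i => epsProx (c i)) l (𝓝 0) := by
  have hcont : ContinuousAt epsProx 2 := by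
    unfold epsProx
    fun_prop (disch := norm_num)
  rw [show (0 : ℝ) = epsProx 2 by norm_num [epsProx]]
  exact hcont.tendsto.comp hc

end Limits

end Constants

section Convergence

variable {G : Type*} [MetricSpace G] {T : G → G} {F F₀ F₁ : G → Set G} {D Ω S Z : Set G} {μ r : ℝ}

lemma AlmostFirmNear.comp_firmCoeff {c α₀ α₁ ε₀ ε₁ : ℝ} (hc : c ∈ Ioc (0 : ℝ) 2)
    (hα₀ : α₀ ∈ Ioo (0 : ℝ) 1) (hα₁ : α₁ ∈ Ioo (0 : ℝ) 1) (hε₁ : 0 ≤ ε₁)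
    (h₁ : AlmostFirmNear F₁ Z S ε₁ (firmCoeff c α₁))
    (h₀ : AlmostFirmNear F₀ Z S ε₀ (firmCoeff c α₀)) (hr : 0 < r)
    (hq : ∀ y ∈ S, QuasiNonexpansiveAt F₀ Ω y r) :
    AlmostFirmNear (composition F₁ F₀) Z S (ε₀ + ε₁ + ε₀ * ε₁)
      (firmCoeff c (alphaComp c α₀ α₁)) :=
  (h₁.comp h₀ hr hq hε₁ (firmCoeff_pos hc.1 hα₀) (firmCoeff_pos hc.1 hα₁)).mono
    Subset.rfl Subset.rfl (firmCoeff_alphaComp_le hc hα₀ hα₁)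

variable {ι : Type*} {l : Filter ι} [l.NeBot] {I : Set ι} {c α ε : ι → ℝ} {a : ℝ}

lemma AlmostFirmNear.limit (ha : a ≠ 0) (hI : I ∈ l) (hc : Tendsto c l (𝓝 2))
    (hα : Tendsto α l (𝓝 a)) (hε : Tendsto ε l (𝓝 0)) (hK : ∀ i ∈ I, 0 ≤ firmCoeff (c i) (α i))
    (h : ∀ i ∈ I, AlmostFirmNear F Z S (ε i) (firmCoeff (c i) (α i))) {e : ℝ} (he : 0 < e) :
    AlmostFirmNear F Z S e (firmCoeff 2 a) := by
  have hlim : Tendsto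
      (fun i => ε i + |firmCoeff 2 a - firmCoeff (c i) (α i)| * (4 + 2 * ε i)) l
      (𝓝 (0 + |firmCoeff 2 a - firmCoeff 2 a| * (4 + 2 * 0))) :=
    hε.add (((tendsto_firmCoeff ha hc hα).const_sub _).abs.mul ((hε.const_mul 2).const_add 4))
  rw [sub_self, abs_zero, zero_mul, add_zero] at hlim
  obtain ⟨i, hie, hi⟩ := ((hlim.eventually_lt_const he).and hI).exists
  exact (h i hi).change_coeff (hK i hi) hie.le

/-- The convergence statement for a mapping `T` near `S`, where `c i`, `α i` and `ε i` are the
uniform convexity parameter, the constant and the violation of `T` for the index `i ∈ I`, the limit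
`c i → 2` is along `l`, and `a` is the asymptotic constant. -/
def ConvergenceAlong (l : Filter ι) (I : Set ι) (T : G → G) (D S : Set G) (μ : ℝ)
    (c α ε : ι → ℝ) (a : ℝ) : Prop :=
  (∀ i ∈ I, rate (c i) (α i) (ε i) μ < 1 → LinearNear T D S (rate (c i) (α i) (ε i) μ)) ∧
  (∀ e > 0, rate 2 a e μ < 1 → LinearNear T D S (rate 2 a e μ)) ∧
  Tendsto (fun i => rate (c i) (α i) (ε i) μ) l (𝓝 (rate 2 a 0 μ)) ∧
  rate 2 a 0 μ < 1 ∧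
  ∃ δ > 0, ∀ y ∈ S, ∀ x₀ ∈ D, dist x₀ y < δ → ConvergesAsymptotically T D (rate 2 a 0 μ) x₀

theorem ConvergenceAlong.of_almostFirmNear [CompleteSpace G] (hT : IsSubregularSelfMap T D μ)
    (hsel : ∀ x ∈ D, T x ∈ F x) (hS : S ⊆ Ω ∩ D) (ha : a ∈ Ioo (0 : ℝ) 1) (hI : I ∈ l)
    (hc : Tendsto c l (𝓝 2)) (hα : Tendsto α l (𝓝 a)) (hε : Tendsto ε l (𝓝 0))
    (hK : ∀ i ∈ I, 0 ≤ firmCoeff (c i) (α i))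
    (hr : 0 < r) (hq : ∀ y ∈ S, QuasiNonexpansiveAt F Ω y r)
    (hfirm : ∀ i ∈ I, AlmostFirmNear F (Ω ∩ D) S (ε i) (firmCoeff (c i) (α i)))
    (hq' : ∀ z ∈ Ω ∩ D, ∃ r > 0, QuasiNonexpansiveAt F Ω z r)
    (hfirm' : ∀ z ∈ Ω ∩ D, ∀ i ∈ I,
      AlmostFirmNear F (Ω ∩ D) {z} (ε i) (firmCoeff (c i) (α i))) :
    ConvergenceAlong l I T D S μ c α ε a := by
  have hK' := firmCoeff_pos two_pos ha
  have hlimit (e : ℝ) (he : e > 0) : AlmostFirmNear F (Ω ∩ D) S e (firmCoeff 2 a) :=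
    .limit ha.1.ne' hI hc hα hε hK hfirm he
  have hlimit' (z) (hz : z ∈ Ω ∩ D) (e : ℝ) (he : e > 0) :
      AlmostFirmNear F (Ω ∩ D) {z} e (firmCoeff 2 a) :=
    .limit ha.1.ne' hI hc hα hε hK (hfirm' z hz) he
  refine ⟨fun i hi => ?_, fun e he => ?_, tendsto_rate μ ha.1.ne' hc hα hε,
    rate_lt_one two_pos ha hT.pos, ?_⟩
  · rw [rate_eq]
    exact linearNear_of_almostFirmNear hT hsel hS hr hq (hfirm i hi) (hK i hi)
  · rw [rate_eq]
    exact linearNear_of_almostFirmNear hT hsel hS hr hq (hlimit e he) hK'.le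
  · rw [rate_eq, add_zero]
    exact exists_convergesAsymptotically_of_almostFirmNear hT hsel hS hr hq hlimit hq' hlimit' hK'

theorem ConvergenceNear.of_almostFirmNear [CompleteSpace G] (hT : IsSubregularSelfMap T D μ)
    (hsel : ∀ x ∈ D, T x ∈ F x) {α ε : ℝ → ℝ} (ha : a ∈ Ioo (0 : ℝ) 1)
    (hα : Tendsto α (𝓝[<] 2) (𝓝 a)) (hε : Tendsto ε (𝓝[<] 2) (𝓝 0))
    (hK : ∀ c ∈ Ioo (1 : ℝ) 2, 0 ≤ firmCoeff c (α c)) (hr : 0 < r)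
    (hq : ∀ y ∈ Ω, QuasiNonexpansiveAt F Ω y r)
    (hfirm : ∀ c ∈ Ioo (1 : ℝ) 2, AlmostFirmNear F Ω Ω (ε c) (firmCoeff c (α c))) :
    ConvergenceNear T D Ω μ α ε a :=
  ConvergenceAlong.of_almostFirmNear hT hsel Subset.rfl ha (Ioo_mem_nhdsLT one_lt_two)
    (tendsto_id'.2 nhdsWithin_le_nhds) hα hε hK hr (fun y hy => hq y hy.1)
    (fun c hc => (hfirm c hc).mono inter_subset_left inter_subset_left le_rfl)
    (fun z hz => ⟨r, hr, hq z hz.1⟩)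
    (fun _ hz c hc => (hfirm c hc).mono inter_subset_left (singleton_subset_iff.2 hz.1) le_rfl)

end Convergence

section Trigonometry

open Real

lemma exists_le_cos_pow_three {η : ℝ} (hη : η < 1) : ∃ δ ∈ Ioo 0 (π / 2), η ≤ cos δ ^ 3 := by
  have hlim : Tendsto (fun x : ℝ => cos x ^ 3) (𝓝[>] 0) (𝓝 1) := by
    simpa using (Continuous.tendsto (by fun_prop : Continuous fun x : ℝ => cos x ^ 3) 0).mono_left
      nhdsWithin_le_nhds
  obtain ⟨δ, hηδ, hδ⟩ :=
    ((hlim.eventually_const_lt hη).and (Ioo_mem_nhdsGT (half_pos pi_pos))).exists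
  exact ⟨δ, hδ, hηδ.le⟩

lemma cos_pos_of_lt_pi_div_two {v : ℝ} (hv : 0 ≤ v) (hv' : v < π / 2) : 0 < cos v :=
  cos_pos_of_mem_Ioo ⟨by linarith [pi_pos], hv'⟩

lemma le_of_cos_le_cos {D E : ℝ} (hD : D ≤ π) (hE : 0 ≤ E) (h : cos E ≤ cos D) : D ≤ E := by
  by_contra! hlt
  exact absurd (cos_lt_cos_of_nonneg_of_le_pi hE hD hlt) (not_lt.2 h)

lemma mul_cos_le_sin {v δ : ℝ} (hv : 0 ≤ v) (hvδ : v ≤ δ) (hδ : δ < π / 2) :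
    v * cos δ ≤ sin v :=
  calc v * cos δ ≤ v * cos v :=
        mul_le_mul_of_nonneg_left (cos_le_cos_of_nonneg_of_le_pi hv (by linarith) hvδ) hv
    _ ≤ sin v := by
        rw [← le_div_iff₀ (cos_pos_of_lt_pi_div_two hv (by linarith)), ← tan_eq_sin_div_cos]
        exact le_tan hv (by linarith)

lemma sq_mul_sq_cos_le_one_sub_cos {b δ : ℝ} (hb : 0 ≤ b) (hbδ : b ≤ δ) (hδ : δ < π / 2) :
    cos δ ^ 2 * b ^ 2 / 2 ≤ 1 - cos b := by
  have hcos : 0 < cos δ := cos_pos_of_lt_pi_div_two (hb.trans hbδ) hδ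
  have hsin : (b / 2 * cos δ) ^ 2 ≤ sin (b / 2) ^ 2 :=
    pow_le_pow_left₀ (by positivity) (mul_cos_le_sin (by linarith) (by linarith) hδ) 2
  have hhalf : sin (b / 2) ^ 2 = (1 - cos b) / 2 := by
    rw [sin_sq_eq_half_sub, mul_div_cancel₀ b two_ne_zero]
    ring
  linarith

lemma cos_sub_cos_le {D E : ℝ} (hD : 0 ≤ D) (hDE : D ≤ E) :
    cos D - cos E ≤ (E ^ 2 - D ^ 2) / 2 := by
  have habs : |sin ((E + D) / 2) * sin ((E - D) / 2)| ≤ (E + D) / 2 * ((E - D) / 2) := by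
    rw [abs_mul]
    refine mul_le_mul ?_ ?_ (abs_nonneg _) (by linarith)
    · exact abs_sin_le_abs.trans_eq (abs_of_nonneg (by linarith))
    · exact abs_sin_le_abs.trans_eq (abs_of_nonneg (by linarith))
  calc cos D - cos E = 2 * (sin ((E + D) / 2) * sin ((E - D) / 2)) := by
        rw [← neg_sub, cos_sub_cos]
        ring
    _ ≤ 2 * ((E + D) / 2 * ((E - D) / 2)) := by
        exact mul_le_mul_of_nonneg_left ((le_abs_self _).trans habs) zero_le_two
    _ = (E ^ 2 - D ^ 2) / 2 := by ring

lemma sq_add_le_sq_of_cos_le_cos_mul_cos {a b C δ : ℝ} (hδ : δ < π / 2) (ha : 0 ≤ a)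
    (hb : 0 ≤ b) (haδ : a ≤ δ) (hbδ : b ≤ δ) (hC : 0 ≤ C) (h : cos C ≤ cos a * cos b) :
    a ^ 2 + cos δ ^ 3 * b ^ 2 ≤ C ^ 2 := by
  have hcos : 0 < cos δ := cos_pos_of_lt_pi_div_two (ha.trans haδ) hδ
  have hcosa : cos δ ≤ cos a := cos_le_cos_of_nonneg_of_le_pi ha (by linarith) haδ
  have haC : a ≤ C := le_of_cos_le_cos (by linarith) hC
    (h.trans (mul_le_of_le_one_right (hcos.le.trans hcosa) (cos_le_one b)))
  have hgap : cos δ * (cos δ ^ 2 * b ^ 2 / 2) ≤ cos a * (1 - cos b) :=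
    mul_le_mul hcosa (sq_mul_sq_cos_le_one_sub_cos hb hbδ hδ) (by positivity) (hcos.le.trans hcosa)
  linarith [cos_sub_cos_le ha haC]

lemma convexOn_cos_sqrt : ConvexOn ℝ (Icc 0 (π ^ 2)) fun s => cos √s := by
  have hderiv : ∀ s : ℝ, 0 < s → HasDerivAt (fun s => cos √s) (-sin √s * (1 / (2 * √s))) s :=
    fun s hs => (hasDerivAt_cos _).comp s (hasDerivAt_sqrt hs.ne')
  refine MonotoneOn.convexOn_of_deriv (convex_Icc _ _) (by fun_prop) ?_ ?_ <;> rw [interior_Icc]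
  · exact fun s hs => (hderiv s hs.1).differentiableAt.differentiableWithinAt
  intro s hs t ht hst
  rw [(hderiv s hs.1).deriv, (hderiv t ht.1).deriv]
  have hs0 : 0 < √s := sqrt_pos.2 hs.1
  have ht0 : 0 < √t := sqrt_pos.2 ht.1
  have hsecant := strictConcaveOn_sin_Icc.concaveOn.neg.secant_mono (a := 0) (x := √s) (y := √t)
    ⟨le_rfl, pi_pos.le⟩ ⟨hs0.le, sqrt_le_iff.2 ⟨pi_pos.le, hs.2.le⟩⟩
    ⟨ht0.le, sqrt_le_iff.2 ⟨pi_pos.le, ht.2.le⟩⟩ hs0.ne' ht0.ne' (sqrt_le_sqrt hst)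
  simp only [Pi.neg_apply, sin_zero, neg_zero, sub_zero] at hsecant
  calc -sin √s * (1 / (2 * √s)) = -sin √s / √s / 2 := by field_simp
    _ ≤ -sin √t / √t / 2 := by linarith
    _ = _ := by field_simp

lemma cos_sqrt_le {A B t : ℝ} (hA : A ∈ Icc 0 π) (hB : B ∈ Icc 0 π) (ht : t ∈ Icc 0 1) :
    cos √((1 - t) * A ^ 2 + t * B ^ 2) ≤ (1 - t) * cos A + t * cos B := by
  have hconv := convexOn_cos_sqrt.2 ⟨sq_nonneg A, pow_le_pow_left₀ hA.1 hA.2 2⟩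
    ⟨sq_nonneg B, pow_le_pow_left₀ hB.1 hB.2 2⟩ (sub_nonneg.2 ht.2) ht.1 (by ring)
  simpa only [smul_eq_mul, sqrt_sq hA.1, sqrt_sq hB.1] using hconv

lemma mul_sin_le_sin_mul {t x : ℝ} (ht : t ∈ Icc 0 1) (hx : x ∈ Icc 0 π) :
    t * sin x ≤ sin (t * x) := by
  simpa using strictConcaveOn_sin_Icc.concaveOn.2 (x := 0) ⟨le_rfl, pi_pos.le⟩ hx
    (sub_nonneg.2 ht.2) ht.1 (by ring)

lemma sin_add_sin_sub_sin_add (x y : ℝ) :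
    sin (2 * x) + sin (2 * y) - sin (2 * (x + y)) = 4 * (sin x * sin y * sin (x + y)) := by
  simp only [sin_two_mul, sin_add, cos_add]
  linear_combination (-2 * sin x * cos x) * sin_sq_add_cos_sq y +
    (-2 * sin y * cos y) * sin_sq_add_cos_sq x

lemma sin_mul_add_le_sin_add_sin {l δ t : ℝ} (hl : 0 ≤ l) (hlδ : l ≤ δ) (hδ : δ < π / 2)
    (ht : t ∈ Icc 0 1) :
    sin l * (1 + cos δ ^ 2 * (t * (1 - t) * l ^ 2) / 2) ≤ sin ((1 - t) * l) + sin (t * l) := by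
  have ht' : 0 ≤ 1 - t := sub_nonneg.2 ht.2
  have hcos : 0 < cos δ := cos_pos_of_lt_pi_div_two (hl.trans hlδ) hδ
  have hhalf : 0 ≤ sin (l / 2) := sin_nonneg_of_nonneg_of_le_pi (by linarith) (by linarith)
  have hdouble : sin l ≤ 2 * sin (l / 2) := by
    have hsin := sin_two_mul (l / 2)
    rw [mul_div_cancel₀ l two_ne_zero] at hsin
    exact hsin.trans_le (mul_le_of_le_one_right (by positivity) (cos_le_one _))
  have hprod : ((1 - t) * (l / 2) * cos δ) * (t * (l / 2) * cos δ) ≤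
      sin ((1 - t) * (l / 2)) * sin (t * (l / 2)) := by
    have h₁ := mul_cos_le_sin (v := (1 - t) * (l / 2)) (by positivity) (by nlinarith [ht.1]) hδ
    have h₀ := mul_cos_le_sin (v := t * (l / 2)) (mul_nonneg ht.1 (by positivity))
      (by nlinarith [ht.1]) hδ
    exact mul_le_mul h₁ h₀ (mul_nonneg (mul_nonneg ht.1 (by positivity)) hcos.le)
      (le_trans (by positivity) h₁)
  have hid := sin_add_sin_sub_sin_add ((1 - t) * (l / 2)) (t * (l / 2))
  rw [show 2 * ((1 - t) * (l / 2)) = (1 - t) * l by ring, show 2 * (t * (l / 2)) = t * l by ring,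
    show (1 - t) * (l / 2) + t * (l / 2) = l / 2 by ring, mul_div_cancel₀ l two_ne_zero] at hid
  have hq : 0 ≤ cos δ ^ 2 * (t * (1 - t) * l ^ 2) / 2 := by
    have := ht.1
    positivity
  linarith [mul_le_mul_of_nonneg_right hdouble hq, mul_le_mul_of_nonneg_right hprod hhalf]

lemma cos_le_cos_of_stewart {A B D R l t : ℝ} (ht : t ∈ Icc 0 1) (hl : l ∈ Ioo 0 π)
    (hR : 0 ≤ cos R) (hA : cos R ≤ cos A) (hB : cos R ≤ cos B)
    (h : sin ((1 - t) * l) * cos A + sin (t * l) * cos B ≤ cos D * sin l) : cos R ≤ cos D := by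
  have hsin : 0 < sin l := sin_pos_of_pos_of_lt_pi hl.1 hl.2
  have ht' : 1 - t ∈ Icc (0 : ℝ) 1 := ⟨by linarith [ht.2], by linarith [ht.1]⟩
  have hleft := mul_sin_le_sin_mul ht' (Ioo_subset_Icc_self hl)
  have hright := mul_sin_le_sin_mul ht (Ioo_subset_Icc_self hl)
  refine le_of_mul_le_mul_right (le_trans ?_ h) hsin
  calc cos R * sin l = (1 - t) * sin l * cos R + t * sin l * cos R := by ring
    _ ≤ sin ((1 - t) * l) * cos A + sin (t * l) * cos B :=
        add_le_add
          (mul_le_mul hleft hA hR ((mul_nonneg ht'.1 hsin.le).trans hleft))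
          (mul_le_mul hright hB hR ((mul_nonneg ht.1 hsin.le).trans hright))

lemma sq_le_of_stewart {A B D l δ t : ℝ} (hδ : δ < π / 2) (ht : t ∈ Icc 0 1)
    (hA : A ∈ Icc 0 δ) (hB : B ∈ Icc 0 δ) (hD : D ∈ Icc 0 π) (hl : l ∈ Ioc 0 δ)
    (h : sin ((1 - t) * l) * cos A + sin (t * l) * cos B ≤ cos D * sin l) :
    D ^ 2 ≤ (1 - t) * A ^ 2 + t * B ^ 2 - cos δ ^ 3 * (t * (1 - t) * l ^ 2) := by
  have hδπ : δ < π := hδ.trans (half_lt_self pi_pos)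
  have ht' : 1 - t ∈ Icc (0 : ℝ) 1 := ⟨by linarith [ht.2], by linarith [ht.1]⟩
  have hcosδ : 0 < cos δ := cos_pos_of_lt_pi_div_two (hl.1.le.trans hl.2) hδ
  have hcosA : cos δ ≤ cos A := cos_le_cos_of_nonneg_of_le_pi hA.1 hδπ.le hA.2
  have hcosB : cos δ ≤ cos B := cos_le_cos_of_nonneg_of_le_pi hB.1 hδπ.le hB.2
  have hlπ : l ∈ Icc 0 π := ⟨hl.1.le, hl.2.trans hδπ.le⟩
  have hsin : 0 < sin l := sin_pos_of_pos_of_lt_pi hl.1 (hl.2.trans_lt hδπ)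
  set E := √((1 - t) * A ^ 2 + t * B ^ 2)
  have hEsq : E ^ 2 = (1 - t) * A ^ 2 + t * B ^ 2 :=
    sq_sqrt (add_nonneg (mul_nonneg ht'.1 (sq_nonneg A)) (mul_nonneg ht.1 (sq_nonneg B)))
  have hcosE : cos E ≤ (1 - t) * cos A + t * cos B :=
    cos_sqrt_le ⟨hA.1, hA.2.trans hδπ.le⟩ ⟨hB.1, hB.2.trans hδπ.le⟩ ht
  have hmain : sin l * (cos E + cos δ ^ 3 * (t * (1 - t) * l ^ 2) / 2) ≤ sin l * cos D := by
    have hexcess := mul_le_mul_of_nonneg_left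
      (sin_mul_add_le_sin_add_sin hl.1.le hl.2 hδ ht) hcosδ.le
    have hA' := mul_le_mul_of_nonneg_left hcosA (sub_nonneg.2 (mul_sin_le_sin_mul ht' hlπ))
    have hB' := mul_le_mul_of_nonneg_left hcosB (sub_nonneg.2 (mul_sin_le_sin_mul ht hlπ))
    have hE' := mul_le_mul_of_nonneg_left hcosE hsin.le
    linarith
  have hcosD := le_of_mul_le_mul_left hmain hsin
  have hDE : D ≤ E := by
    refine le_of_cos_le_cos hD.2 (sqrt_nonneg _) (le_trans (le_add_of_nonneg_right ?_) hcosD)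
    have := ht.1
    have := ht'.1
    positivity
  linarith [cos_sub_cos_le hD.1 hDE]

end Trigonometry

section ModelSurface

open Real

/-- The point of the model surface at distance `a` from the pole `polar 0 φ` (in units where the
curvature is `1`), in direction `φ`. -/
noncomputable def polar (a φ : ℝ) : Model :=
  ⟨!₂[cos a, sin a * cos φ, sin a * sin φ], by
    have : cos a ^ 2 + (sin a * cos φ) ^ 2 + (sin a * sin φ) ^ 2 = 1 := by
      linear_combination cos_sq_add_sin_sq a + sin a ^ 2 * cos_sq_add_sin_sq φ
    simp [EuclideanSpace.norm_eq, Fin.sum_univ_three, this]⟩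

lemma cos_modelDist_polar {κ : ℝ} (hκ : 0 < κ) (a φ b ψ : ℝ) :
    cos (√κ * modelDist κ (polar a φ) (polar b ψ)) =
      cos a * cos b + sin a * sin b * cos (φ - ψ) := by
  rw [modelDist, mul_div_cancel₀ _ (sqrt_pos.2 hκ).ne', InnerProductGeometry.cos_angle]
  rw [norm_eq_of_mem_sphere, norm_eq_of_mem_sphere, mul_one, div_one, cos_sub]
  simp only [polar, PiLp.inner_apply, RCLike.inner_apply, ringHom_apply, Fin.sum_univ_three,
    Matrix.cons_val_zero, Matrix.cons_val_one, Matrix.cons_val]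
  ring

lemma sqrt_mul_modelDist_mem {κ : ℝ} (hκ : 0 < κ) (u v : Model) :
    √κ * modelDist κ u v ∈ Icc 0 π := by
  rw [modelDist, mul_div_cancel₀ _ (sqrt_pos.2 hκ).ne']
  exact ⟨InnerProductGeometry.angle_nonneg _ _, InnerProductGeometry.angle_le_pi _ _⟩

lemma modelDist_polar_eq {κ : ℝ} (hκ : 0 < κ) {a φ b ψ d : ℝ} (hd : √κ * d ∈ Icc 0 π)
    (h : cos (√κ * d) = cos a * cos b + sin a * sin b * cos (φ - ψ)) :
    modelDist κ (polar a φ) (polar b ψ) = d :=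
  mul_left_cancel₀ (sqrt_pos.2 hκ).ne' <|
    injOn_cos (sqrt_mul_modelDist_mem hκ _ _) hd ((cos_modelDist_polar hκ a φ b ψ).trans h.symm)

lemma exists_cos_eq_cos_mul_cos_add {a b C : ℝ} (hC : |a - b| ≤ C) (hC' : C ≤ a + b)
    (hper : a + b + C ≤ 2 * π) :
    ∃ φ, cos C = cos a * cos b + sin a * sin b * cos φ := by
  have hnonneg : 0 ≤ C := (abs_nonneg _).trans hC
  have hdiff : cos C ≤ cos a * cos b + sin a * sin b * cos 0 := by
    rw [cos_zero, mul_one, ← cos_sub, ← cos_abs (a - b)]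
    exact cos_le_cos_of_nonneg_of_le_pi (abs_nonneg _) (by linarith) hC
  have hsum : cos a * cos b + sin a * sin b * cos π ≤ cos C := by
    rw [cos_pi, mul_neg_one, ← sub_eq_add_neg, ← cos_add]
    rcases le_total (a + b) π with h | h
    · exact cos_le_cos_of_nonneg_of_le_pi hnonneg h hC'
    · rw [← cos_two_pi_sub]
      exact cos_le_cos_of_nonneg_of_le_pi hnonneg (by linarith) (by linarith)
  obtain ⟨φ, -, hφ⟩ := intermediate_value_Icc'
    (f := fun φ => cos a * cos b + sin a * sin b * cos φ) pi_pos.le (by fun_prop) ⟨hsum, hdiff⟩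
  exact ⟨φ, hφ.symm⟩

end ModelSurface

section Triangles

open Real

variable {G : Type*} [MetricSpace G] {κ t : ℝ} {p q r : G} {γ : ℝ → G}

lemma IsGeodesic.dist_left {x y : G} (h : IsGeodesic γ x y) (ht : t ∈ Icc (0 : ℝ) 1) :
    dist x (γ t) = t * dist x y := by
  have hdist := h.2.2 0 ⟨le_rfl, zero_le_one⟩ t ht
  rwa [h.1, zero_sub, abs_neg, abs_of_nonneg ht.1] at hdist

lemma IsGeodesic.dist_right {x y : G} (h : IsGeodesic γ x y) (ht : t ∈ Icc (0 : ℝ) 1) :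
    dist (γ t) y = (1 - t) * dist x y := by
  have hdist := h.2.2 t ht 1 ⟨zero_le_one, le_rfl⟩
  rwa [h.2.1, abs_sub_comm, abs_of_nonneg (by linarith [ht.2])] at hdist

lemma sqrt_mul_dist_cevian_lt (hper : √κ * (dist p q + dist p r + dist q r) < 2 * π)
    (hγ : IsGeodesic γ p q) (ht : t ∈ Icc (0 : ℝ) 1) : √κ * dist (γ t) r < π := by
  have hle : 2 * dist (γ t) r ≤ dist p q + dist p r + dist q r := by
    linarith [dist_triangle_left (γ t) r p, dist_triangle (γ t) q r, hγ.dist_left ht,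
      hγ.dist_right ht]
  linarith [mul_le_mul_of_nonneg_left hle (sqrt_nonneg κ)]

lemma sqrt_mul_dist_mem (h : √κ * (dist p q + dist p r + dist q r) < 2 * π) :
    √κ * dist p q ∈ Ico 0 π :=
  ⟨by positivity, by
    linarith [mul_le_mul_of_nonneg_left (dist_triangle_right p q r) (sqrt_nonneg κ)]⟩

lemma exists_comparison_angle (κ : ℝ) (hper : √κ * (dist p q + dist p r + dist q r) < 2 * π) :
    ∃ φ, cos (√κ * dist q r) = cos (√κ * dist p q) * cos (√κ * dist p r) +
      sin (√κ * dist p q) * sin (√κ * dist p r) * cos φ := by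
  have hk := sqrt_nonneg κ
  refine exists_cos_eq_cos_mul_cos_add ?_ ?_ (by linarith)
  · rw [← mul_sub, abs_mul, abs_of_nonneg hk, dist_comm p q, dist_comm p r]
    exact mul_le_mul_of_nonneg_left (abs_dist_sub_le q r p) hk
  · rw [← mul_add]
    exact mul_le_mul_of_nonneg_left (dist_triangle_left q r p) hk

variable (hG : IsCAT κ G) (hκ : 0 < κ)
include hG hκ

lemma IsCAT.le_cos_dist (hper : √κ * (dist p q + dist p r + dist q r) < 2 * π)
    (hγ : IsGeodesic γ p q) (ht : t ∈ Icc (0 : ℝ) 1) {φ : ℝ}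
    (hφ : cos (√κ * dist q r) = cos (√κ * dist p q) * cos (√κ * dist p r) +
      sin (√κ * dist p q) * sin (√κ * dist p r) * cos φ) :
    cos (t * (√κ * dist p q)) * cos (√κ * dist p r) +
      sin (t * (√κ * dist p q)) * sin (√κ * dist p r) * cos φ ≤ cos (√κ * dist (γ t) r) := by
  have hk : 0 < √κ := sqrt_pos.2 hκ
  have hpr : √κ * dist p r ∈ Ico 0 π :=
    sqrt_mul_dist_mem (r := q) (by rw [dist_comm r q]; linarith)
  have hqr : √κ * dist q r ∈ Ico 0 π :=
    sqrt_mul_dist_mem (r := p) (by rw [dist_comm q p, dist_comm r p]; linarith)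
  have hscale {s d : ℝ} (hs : s ∈ Icc (0 : ℝ) 1) (hd : √κ * d ∈ Ico 0 π) :
      √κ * (s * d) ∈ Icc 0 π := by
    rw [mul_left_comm]
    exact ⟨mul_nonneg hs.1 hd.1, (mul_le_of_le_one_left hd.1 hs.2).trans hd.2.le⟩
  have hpq := sqrt_mul_dist_mem hper
  obtain ⟨ζ, hζ⟩ := hG.exists_geodesic p r ((lt_div_iff₀' hk).2 hpr.2)
  have hcomp := hG.comparison p q r
    (by rw [lt_div_iff₀' hk, dist_comm r p, add_right_comm]; exact hper)
    γ ζ hγ hζ t ht 1 ⟨zero_le_one, le_rfl⟩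
    (polar 0 0) (polar (√κ * dist p q) 0) (polar (√κ * dist p r) φ)
    (polar (t * (√κ * dist p q)) 0) (polar (√κ * dist p r) φ)
    (modelDist_polar_eq hκ (Ico_subset_Icc_self hpq) (by simp))
    (modelDist_polar_eq hκ (Ico_subset_Icc_self hqr) (by rw [hφ, zero_sub, cos_neg]))
    (modelDist_polar_eq hκ (by rw [dist_comm]; exact Ico_subset_Icc_self hpr)
      (by simp [dist_comm]))
    (modelDist_polar_eq hκ (hscale ht hpq) (by simp [mul_left_comm]))
    (modelDist_polar_eq hκ (hscale ⟨by linarith [ht.2], by linarith [ht.1]⟩ hpq)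
      (by rw [sub_self, cos_zero, mul_one, ← cos_sub, ← cos_neg]; ring_nf))
    (modelDist_polar_eq hκ (hscale ⟨zero_le_one, le_rfl⟩ hpr) (by simp))
    (modelDist_polar_eq hκ (hscale ⟨by norm_num, by norm_num⟩ hpr)
      (by rw [sub_self, sub_self, zero_mul, mul_zero, cos_zero, mul_one, ← cos_sub, sub_self,
        cos_zero]))
  rw [hζ.2.1] at hcomp
  calc _ = cos (√κ * modelDist κ (polar (t * (√κ * dist p q)) 0) (polar (√κ * dist p r) φ)) := by
        rw [cos_modelDist_polar hκ, zero_sub, cos_neg]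
    _ ≤ _ := cos_le_cos_of_nonneg_of_le_pi (by positivity) (sqrt_mul_modelDist_mem hκ _ _).2
        (mul_le_mul_of_nonneg_left hcomp hk.le)

lemma IsCAT.stewart (hper : √κ * (dist p q + dist p r + dist q r) < 2 * π)
    (hγ : IsGeodesic γ p q) (ht : t ∈ Icc (0 : ℝ) 1) :
    sin ((1 - t) * (√κ * dist p q)) * cos (√κ * dist p r) +
      sin (t * (√κ * dist p q)) * cos (√κ * dist q r) ≤
      cos (√κ * dist (γ t) r) * sin (√κ * dist p q) := by
  obtain ⟨φ, hφ⟩ := exists_comparison_angle κ hper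
  have hpq := sqrt_mul_dist_mem hper
  refine le_trans (le_of_eq ?_) (mul_le_mul_of_nonneg_right (hG.le_cos_dist hκ hper hγ ht hφ)
    (sin_nonneg_of_nonneg_of_le_pi hpq.1 hpq.2.le))
  rw [hφ, sub_mul, one_mul, sin_sub]
  ring

end Triangles

section Relaxation

open Real

variable {G : Type*} [MetricSpace G] {κ t R : ℝ} {x q m y : G}

lemma dist_of_mem_combo (ht : t ∈ Icc (0 : ℝ) 1) (hm : m ∈ combo t x q) :
    dist x m = t * dist x q := by
  obtain ⟨γ, hγ, rfl⟩ := hm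
  exact hγ.dist_left ht

lemma eq_of_mem_combo_self (ht : t ∈ Icc (0 : ℝ) 1) (hm : m ∈ combo t x x) : m = x := by
  simpa [eq_comm] using dist_of_mem_combo ht hm

variable (hR : √κ * R < π / 2) (hx : dist x y ≤ R) (hq : dist q y ≤ R)
include hR hx hq

lemma sqrt_mul_perimeter_lt : √κ * (dist x q + dist x y + dist q y) < 2 * π := by
  have hle : dist x q + dist x y + dist q y ≤ 4 * R := by linarith [dist_triangle_right x q y]
  linarith [mul_le_mul_of_nonneg_left hle (sqrt_nonneg κ)]

variable (hG : IsCAT κ G) (hκ : 0 < κ) (hm : m ∈ combo t x q) (ht : t ∈ Icc (0 : ℝ) 1)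
include hG hκ hm ht

lemma IsCAT.dist_combo_le : dist m y ≤ R := by
  have hk : 0 < √κ := sqrt_pos.2 hκ
  obtain rfl | hne := eq_or_ne x q
  · rwa [eq_of_mem_combo_self ht hm]
  obtain ⟨γ, hγ, rfl⟩ := hm
  have hper := sqrt_mul_perimeter_lt hR hx hq
  have hxq : √κ * dist x q ∈ Ioo 0 π :=
    ⟨mul_pos hk (dist_pos.2 hne), (sqrt_mul_dist_mem hper).2⟩
  have hR0 : 0 ≤ √κ * R := mul_nonneg hk.le (dist_nonneg.trans hx)
  have hcos {d : ℝ} (hd : 0 ≤ d) (hdR : d ≤ R) : cos (√κ * R) ≤ cos (√κ * d) :=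
    cos_le_cos_of_nonneg_of_le_pi (by positivity) (by linarith)
      (mul_le_mul_of_nonneg_left hdR hk.le)
  have hcosm := cos_le_cos_of_stewart ht hxq (cos_pos_of_lt_pi_div_two hR0 hR).le
    (hcos dist_nonneg hx) (hcos dist_nonneg hq) (hG.stewart hκ hper hγ ht)
  exact le_of_mul_le_mul_left
    (le_of_cos_le_cos (sqrt_mul_dist_cevian_lt hper hγ ht).le hR0 hcosm) hk

lemma IsCAT.sq_dist_combo_le (hxq : dist x q ≤ R) :
    dist m y ^ 2 ≤ (1 - t) * dist x y ^ 2 + t * dist q y ^ 2 -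
      cos (√κ * R) ^ 3 * (t * (1 - t) * dist x q ^ 2) := by
  have hk : 0 < √κ := sqrt_pos.2 hκ
  obtain rfl | hne := eq_or_ne x q
  · rw [eq_of_mem_combo_self ht hm, dist_self]
    linarith
  obtain ⟨γ, hγ, rfl⟩ := hm
  have hper := sqrt_mul_perimeter_lt hR hx hq
  have hscale {d : ℝ} (hd : d ≤ R) : √κ * d ≤ √κ * R := mul_le_mul_of_nonneg_left hd hk.le
  have hsq := sq_le_of_stewart hR ht ⟨by positivity, hscale hx⟩ ⟨by positivity, hscale hq⟩
    ⟨by positivity, (sqrt_mul_dist_cevian_lt hper hγ ht).le⟩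
    ⟨mul_pos hk (dist_pos.2 hne), hscale hxq⟩ (hG.stewart hκ hper hγ ht)
  simp only [mul_pow, sq_sqrt hκ.le] at hsq
  refine le_of_mul_le_mul_left (hsq.trans_eq ?_) hκ
  ring

end Relaxation

section FootPoints

open Real

variable {G : Type*} [MetricSpace G] {κ r : ℝ} {p x y : G}

/-- `p` is a nearest point to `x` on every geodesic from `p` to `y`. -/
structure FootPoint (p x y : G) : Prop where
  dist_le : dist p x ≤ dist y x
  dist_le_geodesic : ∀ γ : ℝ → G, IsGeodesic γ p y → ∀ t ∈ Icc (0 : ℝ) 1, dist p x ≤ dist (γ t) x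

lemma nonpos_of_hasDerivAt_of_forall_le {h : ℝ → ℝ} {h' : ℝ} (hderiv : HasDerivAt h h' 0)
    (hmax : ∀ t ∈ Icc (0 : ℝ) 1, h t ≤ h 0) : h' ≤ 0 := by
  refine le_of_tendsto hderiv.tendsto_slope_zero_right ?_
  filter_upwards [Ioc_mem_nhdsGT one_pos] with t ht
  rw [zero_add]
  exact mul_nonpos_of_nonneg_of_nonpos (inv_nonneg.2 ht.1.le)
    (sub_nonpos.2 (hmax t (Ioc_subset_Icc_self ht)))

lemma sq_add_le_sq_of_cos_mul_le (hκ : 0 < κ) {a b C : ℝ} (hr : √κ * r < π / 2) (ha : 0 ≤ a)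
    (hb : 0 ≤ b) (har : a ≤ r) (hbr : b ≤ r) (hC : 0 ≤ C)
    (h : cos (√κ * C) ≤ cos (√κ * a) * cos (√κ * b)) :
    a ^ 2 + cos (√κ * r) ^ 3 * b ^ 2 ≤ C ^ 2 := by
  have hsq := sq_add_le_sq_of_cos_le_cos_mul_cos hr (by positivity) (by positivity)
    (mul_le_mul_of_nonneg_left har (sqrt_nonneg κ))
    (mul_le_mul_of_nonneg_left hbr (sqrt_nonneg κ)) (by positivity) h
  simp only [mul_pow, sq_sqrt hκ.le] at hsq
  refine le_of_mul_le_mul_left (le_of_eq_of_le ?_ hsq) hκ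
  ring

namespace FootPoint

lemma dist_foot_le (h : FootPoint p x y) : dist p x ≤ dist x y :=
  h.dist_le.trans_eq (dist_comm y x)

lemma perimeter_lt (h : FootPoint p x y) (hxy : √κ * dist x y < π / 2) :
    √κ * (dist p y + dist p x + dist y x) < 2 * π := by
  have hle : dist p y + dist p x + dist y x ≤ 4 * dist x y := by
    linarith [dist_triangle p x y, h.dist_foot_le, dist_comm y x]
  linarith [mul_le_mul_of_nonneg_left hle (sqrt_nonneg κ)]

variable (hG : IsCAT κ G) (hκ : 0 < κ) (h : FootPoint p x y)
include hG hκ h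

/-- Stewart's inequality bounds the distance to `x` along the geodesic from `p` to `y`; since this
distance is minimal at `p`, the derivative of the bound at `p` has a sign, which is the claim. -/
lemma cos_le_cos_mul_cos (hxy : √κ * dist x y < π / 2) :
    cos (√κ * dist x y) ≤ cos (√κ * dist p x) * cos (√κ * dist p y) := by
  obtain rfl | hne := eq_or_ne p y
  · simp [dist_comm]
  have hk : 0 < √κ := sqrt_pos.2 hκ
  have hper := h.perimeter_lt hxy
  have hpy := sqrt_mul_dist_mem hper
  obtain ⟨γ, hγ⟩ := hG.exists_geodesic p y ((lt_div_iff₀' hk).2 hpy.2)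
  have hb : 0 < √κ * dist p y := mul_pos hk (dist_pos.2 hne)
  have hstewart {t : ℝ} (ht : t ∈ Icc (0 : ℝ) 1) :=
    (hG.stewart hκ hper hγ ht).trans <| mul_le_mul_of_nonneg_right
      (cos_le_cos_of_nonneg_of_le_pi (by positivity) (sqrt_mul_dist_cevian_lt hper hγ ht).le
        (mul_le_mul_of_nonneg_left (h.dist_le_geodesic γ hγ t ht) hk.le))
      (sin_nonneg_of_nonneg_of_le_pi hpy.1 hpy.2.le)
  rw [dist_comm x y]
  set b := √κ * dist p y
  set A := cos (√κ * dist p x)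
  set C := cos (√κ * dist y x)
  have hderiv : HasDerivAt (fun t => sin ((1 - t) * b) * A + sin (t * b) * C)
      (b * (C - A * cos b)) 0 := by
    have hleft : HasDerivAt (fun t => (1 - t) * b) (-1 * b) 0 :=
      ((hasDerivAt_id (0 : ℝ)).const_sub 1).mul_const b
    have hright : HasDerivAt (fun t => t * b) (1 * b) 0 := (hasDerivAt_id (0 : ℝ)).mul_const b
    refine ((hleft.sin.mul_const A).add (hright.sin.mul_const C)).congr_deriv ?_
    rw [sub_zero, one_mul, zero_mul, cos_zero]
    ring
  have hle := nonpos_of_hasDerivAt_of_forall_le hderiv fun t ht => by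
    simpa [mul_comm] using hstewart ht
  exact sub_nonpos.1 (nonpos_of_mul_nonpos_right hle hb)

lemma dist_le_dist (hxy : √κ * dist x y < π / 2) : dist p y ≤ dist x y := by
  have hk : 0 < √κ := sqrt_pos.2 hκ
  have hcos := h.cos_le_cos_mul_cos hG hκ hxy
  have hpos : 0 < cos (√κ * dist x y) := cos_pos_of_lt_pi_div_two (by positivity) hxy
  have hfoot : 0 < cos (√κ * dist p x) := cos_pos_of_lt_pi_div_two (by positivity)
    ((mul_le_mul_of_nonneg_left h.dist_foot_le hk.le).trans_lt hxy)
  have hpy : 0 < cos (√κ * dist p y) := pos_of_mul_pos_right (hpos.trans_le hcos) hfoot.le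
  exact le_of_mul_le_mul_left (le_of_cos_le_cos (sqrt_mul_dist_mem (h.perimeter_lt hxy)).2.le
    (by positivity) (hcos.trans (mul_le_of_le_one_left hpy.le (cos_le_one _)))) hk

lemma eq_of_dist_le (hxy : √κ * dist x y < π / 2) (hle : dist x y ≤ dist p y) : p = x := by
  have hk : 0 < √κ := sqrt_pos.2 hκ
  have hcos := h.cos_le_cos_mul_cos hG hκ hxy
  rw [(h.dist_le_dist hG hκ hxy).antisymm hle] at hcos
  have hone : cos 0 ≤ cos (√κ * dist p x) := by
    rw [cos_zero]
    exact (le_mul_iff_one_le_left (cos_pos_of_lt_pi_div_two (by positivity) hxy)).1 hcos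
  have hfoot : √κ * dist p x < π / 2 :=
    (mul_le_mul_of_nonneg_left h.dist_foot_le hk.le).trans_lt hxy
  have hzero := le_of_cos_le_cos (by linarith [pi_pos]) le_rfl hone
  exact dist_le_zero.1 (nonpos_of_mul_nonpos_right hzero hk)

lemma sq_add_sq_le (hr : √κ * r < π / 2) (hxy : dist x y ≤ r) :
    dist p x ^ 2 + cos (√κ * r) ^ 3 * dist p y ^ 2 ≤ dist x y ^ 2 ∧
      dist p y ^ 2 + cos (√κ * r) ^ 3 * dist p x ^ 2 ≤ dist x y ^ 2 := by
  have hxy' : √κ * dist x y < π / 2 :=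
    (mul_le_mul_of_nonneg_left hxy (sqrt_nonneg κ)).trans_lt hr
  have hcos := h.cos_le_cos_mul_cos hG hκ hxy'
  have hpx := h.dist_foot_le.trans hxy
  have hpy := (h.dist_le_dist hG hκ hxy').trans hxy
  exact ⟨sq_add_le_sq_of_cos_mul_le hκ hr dist_nonneg dist_nonneg hpx hpy dist_nonneg hcos,
    sq_add_le_sq_of_cos_mul_le hκ hr dist_nonneg dist_nonneg hpy hpx dist_nonneg
      (hcos.trans_eq (mul_comm _ _))⟩

end FootPoint

end FootPoints

section ProximalMappings

open Real

variable {G : Type*} [MetricSpace G] {κ : ℝ} {f : G → EReal} {l : ℝ} {x y z p : G}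

lemma sqrt_mul_lt_pi_div_two_iff (hκ : 0 < κ) {d : ℝ} :
    √κ * d < π / 2 ↔ d < π / (2 * √κ) := by
  rw [← div_div, lt_div_iff₀' (sqrt_pos.2 hκ)]

/-- A set-valued mapping all of whose values are foot points towards every point of `S`, and whose
fixed points near `S` belong to `S`. Proximal mappings, with `S = argmin f`, and metric projectors
onto convex sets are of this kind. -/
structure IsFootPointMap (κ : ℝ) (F : G → Set G) (S : Set G) : Prop where
  footPoint : ∀ x, ∀ p ∈ F x, ∀ y ∈ S, FootPoint p x y
  mem_of_mem_self : ∀ x, x ∈ F x → ∀ y ∈ S, dist x y < π / (2 * √κ) → x ∈ S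

lemma IsGeodesicallyConvex.isFootPointMap_proj {C : Set G} (hC : IsGeodesicallyConvex C) :
    IsFootPointMap κ (proj C) C where
  footPoint _ p hp y hy :=
    ⟨hp.2 y hy, fun γ hγ t ht => hp.2 _ (hC p hp.1 y hy γ hγ t ht)⟩
  mem_of_mem_self _ hx _ _ _ := hx.1

lemma add_sq_dist_le_of_mem_prox (hp : p ∈ prox f l x) {a b : ℝ} (ha : f p = a) (hb : f z ≤ b) :
    a + dist p x ^ 2 / (2 * l) ≤ b + dist z x ^ 2 / (2 * l) := by
  have hle := (hp z).trans (add_le_add_left hb _)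
  beta_reduce at hle
  rw [ha] at hle
  exact_mod_cast hle

namespace IsProperConvexLsc

variable (hf : IsProperConvexLsc f)
include hf

lemma exists_eq_coe (hx : f x ≠ ⊤) : ∃ a : ℝ, f x = a :=
  ⟨(f x).toReal, (EReal.coe_toReal hx (hf.ne_bot x)).symm⟩

lemma exists_eq_coe_of_mem_argmin (hy : y ∈ argmin f) : ∃ b : ℝ, f y = b :=
  let ⟨x, hx⟩ := hf.proper
  hf.exists_eq_coe (ne_top_of_le_ne_top hx (hy x))

lemma exists_eq_coe_of_mem_prox (hp : p ∈ prox f l x) : ∃ a : ℝ, f p = a := by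
  obtain ⟨z, hz⟩ := hf.proper
  obtain ⟨b, hb⟩ := hf.exists_eq_coe hz
  refine hf.exists_eq_coe fun htop => ?_
  have hle := hp z
  beta_reduce at hle
  rw [htop, hb, EReal.top_add_coe, ← EReal.coe_add, top_le_iff] at hle
  exact EReal.coe_ne_top _ hle

lemma le_of_isGeodesic {γ : ℝ → G} (hγ : IsGeodesic γ x y) {t : ℝ} (ht : t ∈ Icc (0 : ℝ) 1)
    {a b : ℝ} (ha : f x = a) (hb : f y = b) : f (γ t) ≤ ((1 - t) * a + t * b : ℝ) := by
  have hconv := hf.convex x y γ hγ t ht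
  rw [ha, hb] at hconv
  exact_mod_cast hconv

lemma footPoint_of_mem_prox (hl : 0 < l) (hp : p ∈ prox f l x) (hy : y ∈ argmin f) :
    FootPoint p x y := by
  obtain ⟨a, ha⟩ := hf.exists_eq_coe_of_mem_prox hp
  obtain ⟨b, hb⟩ := hf.exists_eq_coe_of_mem_argmin hy
  have hba : b ≤ a := by
    rw [← EReal.coe_le_coe_iff, ← ha, ← hb]
    exact hy p
  have hnear {z : G} (hz : f z ≤ a) : dist p x ≤ dist z x := by
    have hle := le_of_add_le_add_left (add_sq_dist_le_of_mem_prox hp ha hz)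
    rw [div_le_div_iff_of_pos_right (by positivity)] at hle
    exact le_of_sq_le_sq hle dist_nonneg
  refine ⟨hnear (ha ▸ hy p), fun γ hγ t ht => hnear ?_⟩
  refine (hf.le_of_isGeodesic hγ ht ha hb).trans (EReal.coe_le_coe_iff.2 ?_)
  linarith [mul_le_mul_of_nonneg_left hba ht.1]

/-- Moving from a fixed point `x` of the proximal mapping a fraction `t` of the way to a minimizer
changes the quadratic term only by `O(t²)`, so that the decrease of `f` to first order vanishes. -/
lemma mem_argmin_of_mem_prox_self (hG : IsCAT κ G) (hκ : 0 < κ) (hx : x ∈ prox f l x)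
    (hy : y ∈ argmin f) (hxy : dist x y < π / (2 * √κ)) : x ∈ argmin f := by
  obtain ⟨a, ha⟩ := hf.exists_eq_coe_of_mem_prox hx
  obtain ⟨b, hb⟩ := hf.exists_eq_coe_of_mem_argmin hy
  obtain ⟨γ, hγ⟩ := hG.exists_geodesic x y (hxy.trans_le
    (div_le_div_of_nonneg_left pi_pos.le (sqrt_pos.2 hκ) (by linarith [sqrt_nonneg κ])))
  have hderiv : HasDerivAt (fun t => t * (a - b) - (t * dist x y) ^ 2 / (2 * l)) (a - b) 0 := by
    have hlin : HasDerivAt (fun t : ℝ => t) 1 0 := hasDerivAt_id 0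
    refine ((hlin.mul_const (a - b)).sub
      (((hlin.mul_const (dist x y)).pow 2).div_const (2 * l))).congr_deriv ?_
    simp
  have hab : a - b ≤ 0 := nonpos_of_hasDerivAt_of_forall_le hderiv fun t ht => by
    have hle := add_sq_dist_le_of_mem_prox hx ha (hf.le_of_isGeodesic hγ ht ha hb)
    rw [dist_self, dist_comm (γ t), hγ.dist_left ht] at hle
    simp only [zero_mul, sub_zero, zero_pow two_ne_zero, zero_div, add_zero] at hle ⊢
    linarith
  intro z
  calc f x = a := ha
    _ ≤ b := EReal.coe_le_coe_iff.2 (sub_nonpos.1 hab)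
    _ = f y := hb.symm
    _ ≤ f z := hy z

lemma isFootPointMap_prox (hG : IsCAT κ G) (hκ : 0 < κ) (hl : 0 < l) :
    IsFootPointMap κ (prox f l) (argmin f) where
  footPoint _ _ hp _ hy := hf.footPoint_of_mem_prox hl hp hy
  mem_of_mem_self _ hx _ hy hxy := hf.mem_argmin_of_mem_prox_self hG hκ hx hy hxy

end IsProperConvexLsc

end ProximalMappings

section Firmness

open Real

variable {G : Type*} [MetricSpace G] {κ β r : ℝ} {F : G → Set G} {Ω S Z : Set G} {y : G}

lemma exists_radius_le_cos_pow_three (hκ : 0 < κ) {η : ℝ} (hη : η < 1) :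
    ∃ r > 0, √κ * r < π / 2 ∧ η ≤ cos (√κ * r) ^ 3 := by
  have hk : 0 < √κ := sqrt_pos.2 hκ
  obtain ⟨δ, hδ, hcos⟩ := exists_le_cos_pow_three hη
  refine ⟨δ / √κ, div_pos hδ.1 hk, ?_⟩
  rw [mul_div_cancel₀ δ hk.ne']
  exact ⟨hδ.2, hcos⟩

lemma QuasiNonexpansiveAt.relaxation (hG : IsCAT κ G) (hκ : 0 < κ) (hβ : β ∈ Ioc (0 : ℝ) 1)
    (hq : QuasiNonexpansiveAt F Ω y (π / (2 * √κ))) :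
    QuasiNonexpansiveAt (relaxation β F) Ω y (π / (2 * √κ)) where
  mem_of_mem_self x := by
    rintro ⟨q, hqx, hx⟩ hxy
    have hzero := dist_of_mem_combo (Ioc_subset_Icc_self hβ) hx
    rw [dist_self, zero_eq_mul, or_iff_right hβ.1.ne', dist_eq_zero] at hzero
    exact hq.mem_of_mem_self x (hzero ▸ hqx) hxy
  eq_of_mem x hx m := by
    rintro ⟨q, hqx, hm⟩ hxy
    rw [hq.eq_of_mem x hx q hqx hxy] at hm
    exact eq_of_mem_combo_self (Ioc_subset_Icc_self hβ) hm
  dist_le x m := by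
    rintro ⟨q, hqx, hm⟩ hxy
    exact hG.dist_combo_le ((sqrt_mul_lt_pi_div_two_iff hκ).2 hxy) le_rfl
      (hq.dist_le x q hqx hxy) hκ hm (Ioc_subset_Icc_self hβ)

lemma AlmostFirmNear.relaxation (hG : IsCAT κ G) (hκ : 0 < κ) (hβ : β ∈ Ioc (0 : ℝ) 1)
    {c α ε : ℝ} (hc : c < 2) (hα : α ≠ 0) (h : AlmostFirmNear F Z S ε (firmCoeff c α))
    (hr : 0 < r) (hq : ∀ y ∈ S, QuasiNonexpansiveAt F Ω y r) :
    AlmostFirmNear (relaxation β F) Z S (β * ε) (firmCoeff c (α * β)) := by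
  obtain ⟨r₀, hr₀, h⟩ := h
  obtain ⟨R, hR, hRπ, hcos⟩ := exists_radius_le_cos_pow_three hκ (by linarith : c / 2 < 1)
  refine ⟨min r (min r₀ (R / 2)), by positivity, fun y hy x m hm z hz hxy hzy => ?_⟩
  obtain ⟨q, hqx, hm⟩ := hm
  obtain ⟨hxr, hxr₀, hxR⟩ := by simpa only [lt_min_iff] using hxy
  obtain ⟨-, hzr₀, hzR⟩ := by simpa only [lt_min_iff] using hzy
  have hqy := (hq y hy).dist_le x q hqx hxr
  have hcombo := hG.sq_dist_combo_le (y := z) hRπ (by linarith [dist_triangle_right x z y])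
    (by linarith [dist_triangle_right q z y]) hκ hm (Ioc_subset_Icc_self hβ)
    (by linarith [dist_triangle_right x q y])
  have hfirm := mul_le_mul_of_nonneg_left (h y hy x q hqx z hz hxr₀ hzr₀) hβ.1.le
  have hcurv : c / 2 * (β * (1 - β) * dist x q ^ 2) ≤
      cos (√κ * R) ^ 3 * (β * (1 - β) * dist x q ^ 2) :=
    mul_le_mul_of_nonneg_right hcos
      (mul_nonneg (mul_nonneg hβ.1.le (sub_nonneg.2 hβ.2)) (sq_nonneg _))
  rw [dist_of_mem_combo (Ioc_subset_Icc_self hβ) hm, mul_pow, ← mul_assoc,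
    firmCoeff_mul_sq hα hβ.1.ne']
  linarith

namespace IsFootPointMap

variable (h : IsFootPointMap κ F Ω) (hG : IsCAT κ G) (hκ : 0 < κ)
include h hG hκ

lemma strictlyQuasiNonexpansiveAt (hy : y ∈ Ω) :
    StrictlyQuasiNonexpansiveAt F Ω y (π / (2 * √κ)) where
  mem_of_mem_self x hx hxy := h.mem_of_mem_self x hx y hy hxy
  eq_of_mem x hx p hp _ :=
    dist_le_zero.1 ((h.footPoint x p hp x hx).dist_foot_le.trans_eq (dist_self x))
  dist_le x p hp hxy :=
    (h.footPoint x p hp y hy).dist_le_dist hG hκ ((sqrt_mul_lt_pi_div_two_iff hκ).2 hxy)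
  eq_of_dist_le x p hp hxy :=
    (h.footPoint x p hp y hy).eq_of_dist_le hG hκ ((sqrt_mul_lt_pi_div_two_iff hκ).2 hxy)

lemma exists_sq_add_sq_le {η : ℝ} (hη : η < 1) :
    ∃ r > 0, ∀ x, ∀ p ∈ F x, ∀ z ∈ Ω, dist x z < r →
      dist x p ^ 2 + η * dist p z ^ 2 ≤ dist x z ^ 2 ∧
        dist p z ^ 2 + η * dist x p ^ 2 ≤ dist x z ^ 2 := by
  obtain ⟨r, hr, hrπ, hcos⟩ := exists_radius_le_cos_pow_three hκ hη
  refine ⟨r, hr, fun x p hp z hz hxz => ?_⟩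
  obtain ⟨hfoot, hfirm⟩ := (h.footPoint x p hp z hz).sq_add_sq_le hG hκ hrπ hxz.le
  rw [dist_comm x p]
  exact ⟨hfoot.trans' (add_le_add_right (mul_le_mul_of_nonneg_right hcos (sq_nonneg _)) _),
    hfirm.trans' (add_le_add_right (mul_le_mul_of_nonneg_right hcos (sq_nonneg _)) _)⟩

variable {c : ℝ}

lemma almostFirmNear_half (hc : c < 2) : AlmostFirmNear F Ω S 0 (firmCoeff c (1 / 2)) := by
  obtain ⟨r, hr, hle⟩ := h.exists_sq_add_sq_le hG hκ (by linarith : c / 2 < 1)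
  refine .of_dist_lt hr fun x p hp z hz hxz => ?_
  rw [firmCoeff_half]
  linarith [(hle x p hp z hz hxz).2]

lemma almostFirmNear (hc : c ∈ Ioo (1 : ℝ) 2) :
    AlmostFirmNear F Ω S (epsProx c) (firmCoeff c (alphaProx c)) := by
  obtain ⟨r, hr, hle⟩ := h.exists_sq_add_sq_le hG hκ (by linarith [hc.2] : c - 1 < 1)
  refine .of_dist_lt hr fun x p hp z hz hxz => ?_
  rw [one_add_epsProx hc.1, firmCoeff_alphaProx hc.1, ← mul_sub,
    one_div_mul_eq_div, le_div_iff₀' (sub_pos.2 hc.1)]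
  linarith [(hle x p hp z hz hxz).1]

end IsFootPointMap

end Firmness

section SplittingMethods

variable {G : Type*} [MetricSpace G] [CompleteSpace G] {κ μ β : ℝ} {T T₀ : G → G}
  {F F₀ F₁ : G → Set G} {D Ω Ω₀ Ω₁ : Set G}

lemma one_div_two_sub_mem {a : ℝ} (ha : a < 1) : 1 / (2 - a) ∈ Ioo (0 : ℝ) 1 :=
  ⟨one_div_pos.2 (by linarith), (div_lt_one (by linarith)).2 (by linarith)⟩

variable (hG : IsCAT κ G) (hκ : 0 < κ) (hT : IsSubregularSelfMap T D μ)
include hκ hT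

theorem fixedPointsAre_and_convergenceNear (hsel : ∀ x ∈ D, T x ∈ F x) {α ε : ℝ → ℝ} {a : ℝ}
    (ha : a ∈ Ioo (0 : ℝ) 1) (hα : Tendsto α (𝓝[<] 2) (𝓝 a)) (hε : Tendsto ε (𝓝[<] 2) (𝓝 0))
    (hα_mem : ∀ c ∈ Ioo (1 : ℝ) 2, α c ∈ Ioo (0 : ℝ) 1)
    (hq : ∀ y ∈ Ω, QuasiNonexpansiveAt F Ω y (Real.pi / (2 * √κ)))
    (hfirm : ∀ c ∈ Ioo (1 : ℝ) 2, AlmostFirmNear F Ω Ω (ε c) (firmCoeff c (α c))) :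
    FixedPointsAre κ T D Ω ∧ ConvergenceNear T D Ω μ α ε a :=
  ⟨.of_quasiNonexpansiveAt hsel hq, .of_almostFirmNear hT hsel ha hα hε
    (fun c hc => (firmCoeff_pos (one_pos.trans hc.1) (hα_mem c hc)).le) (by positivity) hq hfirm⟩

include hG

theorem fixedPointsAre_and_convergenceNear_comp (h₁ : IsFootPointMap κ F₁ Ω₁)
    (h₀ : IsFootPointMap κ F₀ Ω₀) (hsel : ∀ x ∈ D, T x ∈ composition F₁ F₀ x) :
    FixedPointsAre κ T D (Ω₁ ∩ Ω₀) ∧ ConvergenceNear T D (Ω₁ ∩ Ω₀) μ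
      (fun c => 2 * (c - 1) / (2 * c - 1)) (fun c => 1 / (c - 1) ^ 2 - 1) (2 / 3) := by
  have hα_eq (c : ℝ) (hc : c ∈ Ioo 1 2) := alphaComp_alphaProx hc.1
  have hε_eq (c : ℝ) (hc : c ∈ Ioo 1 2) :
      epsProx c + epsProx c + epsProx c * epsProx c = 1 / (c - 1) ^ 2 - 1 := by
    rw [← one_div_pow, ← one_add_epsProx hc.1]
    ring
  have hα : ContinuousAt (fun c : ℝ => 2 * (c - 1) / (2 * c - 1)) 2 := by
    fun_prop (disch := norm_num)
  have hε : ContinuousAt (fun c : ℝ => 1 / (c - 1) ^ 2 - 1) 2 := by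
    fun_prop (disch := norm_num)
  refine fixedPointsAre_and_convergenceNear hκ hT hsel (by norm_num)
    ((hα.tendsto.mono_left nhdsWithin_le_nhds).trans_eq (by norm_num))
    ((hε.tendsto.mono_left nhdsWithin_le_nhds).trans_eq (by norm_num)) (fun c hc => ?_)
    (fun y hy => (h₁.strictlyQuasiNonexpansiveAt hG hκ hy.1).comp
      (h₀.strictlyQuasiNonexpansiveAt hG hκ hy.2).toQuasiNonexpansiveAt) fun c hc => ?_
  · have hα_mem := alphaProx_mem hc.1
    rw [← hα_eq c hc]
    exact alphaComp_mem (one_pos.trans hc.1) hα_mem hα_mem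
  · have hα_mem := alphaProx_mem hc.1
    rw [← hα_eq c hc, ← hε_eq c hc]
    exact .comp_firmCoeff ⟨one_pos.trans hc.1, hc.2.le⟩ hα_mem hα_mem
      (epsProx_nonneg ⟨hc.1, hc.2.le⟩)
      ((h₁.almostFirmNear hG hκ hc).mono inter_subset_left Subset.rfl le_rfl)
      ((h₀.almostFirmNear hG hκ hc).mono inter_subset_right Subset.rfl le_rfl) (by positivity)
      fun y hy => (h₀.strictlyQuasiNonexpansiveAt hG hκ hy.2).toQuasiNonexpansiveAt

theorem fixedPointsAre_and_convergenceNear_relaxation (h : IsFootPointMap κ F Ω)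
    (hβ : β ∈ Ioc (0 : ℝ) 1) (hsel : ∀ x ∈ D, T x ∈ relaxation β F x) :
    FixedPointsAre κ T D Ω ∧ ConvergenceNear T D Ω μ
      (fun c => alphaProx c * β) (fun c => β * epsProx c) (β / 2) := by
  have hc2 : Tendsto (fun c : ℝ => c) (𝓝[<] 2) (𝓝 2) := nhdsWithin_le_nhds
  refine fixedPointsAre_and_convergenceNear hκ hT hsel
    ⟨half_pos hβ.1, (half_lt_self hβ.1).trans_le hβ.2⟩ (tendsto_alphaProx_mul β hc2)
    (by simpa only [mul_zero] using (tendsto_epsProx hc2).const_mul β)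
    (fun c hc => alphaProx_mul_mem hc.1 hβ)
    (fun y hy => (h.strictlyQuasiNonexpansiveAt hG hκ hy).toQuasiNonexpansiveAt.relaxation
      hG hκ hβ)
    fun c hc => (h.almostFirmNear hG hκ hc).relaxation hG hκ hβ hc.2 (alphaProx_mem hc.1).1.ne'
      (by positivity) fun y hy =>
        (h.strictlyQuasiNonexpansiveAt hG hκ hy).toQuasiNonexpansiveAt

theorem fixedPointsAre_and_convergenceNear_comp_relaxation (h₁ : IsFootPointMap κ F₁ Ω₁)
    (h₀ : IsFootPointMap κ F₀ Ω₀) (hβ : β ∈ Ioc (0 : ℝ) 1)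
    (hsel : ∀ x ∈ D, T x ∈ composition F₁ (relaxation β F₀) x) {α₁ ε₁ ε : ℝ → ℝ}
    (hα₁_mem : ∀ c ∈ Ioo (1 : ℝ) 2, α₁ c ∈ Ioo (0 : ℝ) 1)
    (hα₁ : Tendsto α₁ (𝓝[<] 2) (𝓝 (1 / 2)))
    (hε₁_nonneg : ∀ c ∈ Ioo (1 : ℝ) 2, 0 ≤ ε₁ c) (hε₁ : Tendsto ε₁ (𝓝[<] 2) (𝓝 0))
    (hε : ∀ c, β * epsProx c + ε₁ c + β * epsProx c * ε₁ c = ε c)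
    (hfirm₁ : ∀ c ∈ Ioo (1 : ℝ) 2,
      AlmostFirmNear F₁ Ω₁ (Ω₁ ∩ Ω₀) (ε₁ c) (firmCoeff c (α₁ c))) :
    FixedPointsAre κ T D (Ω₁ ∩ Ω₀) ∧ ConvergenceNear T D (Ω₁ ∩ Ω₀) μ
      (fun c => alphaComp c (alphaProx c * β) (α₁ c)) ε (1 / (2 - β / 2)) := by
  obtain rfl : _ = ε := funext hε
  have hc2 : Tendsto (fun c : ℝ => c) (𝓝[<] 2) (𝓝 2) := nhdsWithin_le_nhds
  have hβε : Tendsto (fun c => β * epsProx c) (𝓝[<] 2) (𝓝 0) := by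
    simpa only [mul_zero] using (tendsto_epsProx hc2).const_mul β
  have hβ2 : β / 2 < 1 := (half_lt_self hβ.1).trans_le hβ.2
  have hq (y : G) (hy : y ∈ Ω₁ ∩ Ω₀) :=
    (h₀.strictlyQuasiNonexpansiveAt hG hκ hy.2).toQuasiNonexpansiveAt
  refine fixedPointsAre_and_convergenceNear hκ hT hsel (one_div_two_sub_mem hβ2)
    (tendsto_alphaComp hβ2 hc2 (tendsto_alphaProx_mul β hc2) hα₁)
    (by simpa only [add_zero, mul_zero] using (hβε.add hε₁).add (hβε.mul hε₁))
    (fun c hc => alphaComp_mem (one_pos.trans hc.1) (alphaProx_mul_mem hc.1 hβ) (hα₁_mem c hc))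
    (fun y hy => (h₁.strictlyQuasiNonexpansiveAt hG hκ hy.1).comp ((hq y hy).relaxation hG hκ hβ))
    fun c hc => ?_
  have hfirm₀ : AlmostFirmNear (relaxation β F₀) (Ω₁ ∩ Ω₀) (Ω₁ ∩ Ω₀) (β * epsProx c)
      (firmCoeff c (alphaProx c * β)) :=
    ((h₀.almostFirmNear hG hκ hc).mono inter_subset_right Subset.rfl le_rfl).relaxation hG hκ hβ
      hc.2 (alphaProx_mem hc.1).1.ne' (by positivity) hq
  exact .comp_firmCoeff ⟨one_pos.trans hc.1, hc.2.le⟩ (alphaProx_mul_mem hc.1 hβ) (hα₁_mem c hc)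
    (hε₁_nonneg c hc) ((hfirm₁ c hc).mono inter_subset_left Subset.rfl le_rfl) hfirm₀
    (by positivity) fun y hy => (hq y hy).relaxation hG hκ hβ

theorem fixedPointsAre_and_convergenceNear_comp_relaxation_alphaProx
    (h₁ : IsFootPointMap κ F₁ Ω₁) (h₀ : IsFootPointMap κ F₀ Ω₀) (hβ : β ∈ Ioc (0 : ℝ) 1)
    (hsel : ∀ x ∈ D, T x ∈ composition F₁ (relaxation β F₀) x) :
    FixedPointsAre κ T D (Ω₁ ∩ Ω₀) ∧ ConvergenceNear T D (Ω₁ ∩ Ω₀) μ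
      (fun c => alphaComp c (alphaProx c * β) (alphaProx c))
      (fun c => (1 + β) * epsProx c + β * epsProx c ^ 2) (1 / (2 - β / 2)) := by
  have hc2 : Tendsto (fun c : ℝ => c) (𝓝[<] 2) (𝓝 2) := nhdsWithin_le_nhds
  exact fixedPointsAre_and_convergenceNear_comp_relaxation hG hκ hT h₁ h₀ hβ hsel
    (fun c hc => alphaProx_mem hc.1) (tendsto_alphaProx hc2)
    (fun c hc => epsProx_nonneg ⟨hc.1, hc.2.le⟩) (tendsto_epsProx hc2) (fun c => by ring)
    fun c hc => h₁.almostFirmNear hG hκ hc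

theorem fixedPointsAre_and_convergenceNear_comp_relaxation_half
    (h₁ : IsFootPointMap κ F₁ Ω₁) (h₀ : IsFootPointMap κ F₀ Ω₀) (hβ : β ∈ Ioc (0 : ℝ) 1)
    (hsel : ∀ x ∈ D, T x ∈ composition F₁ (relaxation β F₀) x) :
    FixedPointsAre κ T D (Ω₁ ∩ Ω₀) ∧ ConvergenceNear T D (Ω₁ ∩ Ω₀) μ
      (fun c => 1 / (c / 2 * (1 - alphaProx c * β) + 1)) (fun c => β * epsProx c)
      (1 / (2 - β / 2)) := by
  simp only [← alphaComp_half]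
  exact fixedPointsAre_and_convergenceNear_comp_relaxation hG hκ hT h₁ h₀ hβ hsel
    (fun c _ => ⟨one_half_pos, one_half_lt_one⟩) tendsto_const_nhds (fun c _ => le_rfl)
    tendsto_const_nhds (fun c => by ring) fun c hc => h₁.almostFirmNear_half hG hκ hc.2

theorem convergenceAlong_comp_restriction (h : IsFootPointMap κ F Ω) {α₀ : ℝ}
    (hα₀ : α₀ ∈ Ioo (0 : ℝ) 1) (hsel : ∀ x ∈ D, T x ∈ F (T₀ x))
    (hfirm₀ : IsAsymptoticallyFirm T₀ D (Ω ∩ Function.fixedPoints T₀ ∩ D) α₀)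
    (hq₀ : IsLocallyQuasiNonexpansive T₀ D (Ω ∩ Function.fixedPoints T₀ ∩ D))
    {y : G} (hy : y ∈ Ω ∩ Function.fixedPoints T₀ ∩ D) :
    ConvergenceAlong (𝓝[<] (2 : ℝ) ×ˢ 𝓝[>] (0 : ℝ)) (Ioo 1 2 ×ˢ Ioi 0) T D {y} μ
      (fun i => i.1) (fun i => alphaComp i.1 α₀ (alphaProx i.1))
      (fun i => i.2 + epsProx i.1 + i.2 * epsProx i.1) (1 / (2 - α₀)) := by
  have hc2 : Tendsto (fun i : ℝ × ℝ => i.1) (𝓝[<] 2 ×ˢ 𝓝[>] 0) (𝓝 2) :=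
    tendsto_fst.mono_right nhdsWithin_le_nhds
  have hε₀ : Tendsto (fun i : ℝ × ℝ => i.2) (𝓝[<] 2 ×ˢ 𝓝[>] 0) (𝓝 0) :=
    tendsto_snd.mono_right nhdsWithin_le_nhds
  have hε := tendsto_epsProx hc2
  have hfix : Ω ∩ Function.fixedPoints T₀ ∩ D ⊆ Function.fixedPoints T₀ := fun _ hz => hz.1.2
  have hq₀' (z) (hz : z ∈ Ω ∩ Function.fixedPoints T₀ ∩ D) :=
    hq₀.exists_quasiNonexpansiveAt_restriction hfix hz
      (by positivity : 0 < Real.pi / (2 * √κ))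
  have hq (z) (hz : z ∈ Ω ∩ Function.fixedPoints T₀ ∩ D) : ∃ r > 0,
      QuasiNonexpansiveAt (composition F (restriction T₀ D)) (Ω ∩ Function.fixedPoints T₀) z r := by
    obtain ⟨r, hr, hqz⟩ := hq₀' z hz
    exact ⟨r, hr.1, ((h.strictlyQuasiNonexpansiveAt hG hκ hz.1.1).mono hr.2).comp hqz⟩
  have hfirm (z) (hz : z ∈ Ω ∩ Function.fixedPoints T₀ ∩ D) (i : ℝ × ℝ)
      (hi : i ∈ Ioo (1 : ℝ) 2 ×ˢ Ioi (0 : ℝ)) :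
      AlmostFirmNear (composition F (restriction T₀ D)) (Ω ∩ Function.fixedPoints T₀ ∩ D) {z}
        (i.2 + epsProx i.1 + i.2 * epsProx i.1)
        (firmCoeff i.1 (alphaComp i.1 α₀ (alphaProx i.1))) := by
    obtain ⟨r, hr, hqz⟩ := hq₀' z hz
    exact .comp_firmCoeff ⟨one_pos.trans hi.1.1, hi.1.2.le⟩ hα₀ (alphaProx_mem hi.1.1)
      (epsProx_nonneg ⟨hi.1.1, hi.1.2.le⟩)
      ((h.almostFirmNear hG hκ hi.1).mono (fun _ hz => hz.1.1) Subset.rfl le_rfl)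
      ((AlmostFirmNear.restriction hfirm₀ hfix hz hi.2).mono Subset.rfl Subset.rfl
        (firmCoeff_le_of_le_two hi.1.2.le hα₀)) hr.1 (forall_eq.2 hqz)
  obtain ⟨r, hr, hqy⟩ := hq y hy
  have hsel' (x : G) (hx : x ∈ D) : T x ∈ composition F (restriction T₀ D) x :=
    ⟨T₀ x, ⟨hx, rfl⟩, hsel x hx⟩
  exact .of_almostFirmNear hT hsel'
    (singleton_subset_iff.2 hy) (one_div_two_sub_mem hα₀.2)
    (prod_mem_prod (Ioo_mem_nhdsLT one_lt_two) self_mem_nhdsWithin) hc2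
    (tendsto_alphaComp hα₀.2 hc2 tendsto_const_nhds (tendsto_alphaProx hc2))
    (by simpa only [add_zero, mul_zero] using (hε₀.add hε).add (hε₀.mul hε))
    (fun i hi => (firmCoeff_pos (one_pos.trans hi.1.1)
      (alphaComp_mem (one_pos.trans hi.1.1) hα₀ (alphaProx_mem hi.1.1))).le)
    hr (forall_eq.2 hqy) (hfirm y hy) hq hfirm

end SplittingMethods

end ProxCAT

open ProxCAT in
theorem theorem4p3 {G : Type*} [MetricSpace G] [CompleteSpace G] (κ : ℝ) (hκ : 0 < κ)
    (hG : IsCAT κ G) (f g : G → EReal) (hf : IsProperConvexLsc f) (hg : IsProperConvexLsc g)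
    (D : Set G) (hD : IsClosed D) (T : G → G) (hT : MapsTo T D D) (μ : ℝ) (hμ : 0 < μ)
    (hreg : ∀ x ∈ D, Metric.infDist x (Function.fixedPoints T ∩ D) ≤ μ * dist x (T x)) :
    -- (i) `T = prox_{f,l₂} ∘ prox_{g,l₁}`
    (∀ l₁ > (0 : ℝ), ∀ l₂ > (0 : ℝ),
      (∀ x ∈ D, ∃ q ∈ prox g l₁ x, T x ∈ prox f l₂ q) →
      FixedPointsAre κ T D (argmin f ∩ argmin g) ∧
      ConvergenceNear T D (argmin f ∩ argmin g) μ
        (fun c => 2 * (c - 1) / (2 * c - 1)) (fun c => 1 / (c - 1) ^ 2 - 1) (2 / 3)) ∧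
    -- (ii) `T = prox_{f,l} ∘ T₀`
    (∀ l > (0 : ℝ), ∀ (T₀ : G → G), ∀ α₀ ∈ Ioo (0 : ℝ) 1,
      (∀ x ∈ D, T x ∈ prox f l (T₀ x)) →
      IsAsymptoticallyFirm T₀ D (argmin f ∩ Function.fixedPoints T₀ ∩ D) α₀ →
      IsLocallyQuasiNonexpansive T₀ D (argmin f ∩ Function.fixedPoints T₀ ∩ D) →
      ∀ y ∈ argmin f ∩ Function.fixedPoints T₀ ∩ D,
        (∀ c ∈ Ioo (1 : ℝ) 2, ∀ ε₀ > (0 : ℝ),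
          rate c (alphaComp c α₀ (alphaProx c)) (ε₀ + epsProx c + ε₀ * epsProx c) μ < 1 →
          LinearNear T D {y}
            (rate c (alphaComp c α₀ (alphaProx c)) (ε₀ + epsProx c + ε₀ * epsProx c) μ)) ∧
        (∀ e > (0 : ℝ), rate 2 (1 / (2 - α₀)) e μ < 1 →
          LinearNear T D {y} (rate 2 (1 / (2 - α₀)) e μ)) ∧
        Tendsto (fun z : ℝ × ℝ => rate z.1 (alphaComp z.1 α₀ (alphaProx z.1))
            (z.2 + epsProx z.1 + z.2 * epsProx z.1) μ)
          (𝓝[<] 2 ×ˢ 𝓝[>] 0) (𝓝 (rate 2 (1 / (2 - α₀)) 0 μ)) ∧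
        rate 2 (1 / (2 - α₀)) 0 μ < 1 ∧
        ∃ δ > (0 : ℝ), ∀ x₀ ∈ D, dist x₀ y < δ →
          ConvergesAsymptotically T D (rate 2 (1 / (2 - α₀)) 0 μ) x₀) ∧
    -- (iii) `T = β prox_{f,l} ⊕ (1 - β) Id`
    (∀ l > (0 : ℝ), ∀ β ∈ Ioc (0 : ℝ) 1,
      (∀ x ∈ D, ∃ q ∈ prox f l x, T x ∈ combo β x q) →
      FixedPointsAre κ T D (argmin f) ∧
      ConvergenceNear T D (argmin f) μ
        (fun c => alphaProx c * β) (fun c => β * epsProx c) (β / 2)) ∧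
    -- (iv) `T = prox_{f,l₂} ∘ (β prox_{g,l₁} ⊕ (1 - β) Id)`
    (∀ l₁ > (0 : ℝ), ∀ l₂ > (0 : ℝ), ∀ β ∈ Ioc (0 : ℝ) 1,
      (∀ x ∈ D, ∃ q ∈ prox g l₁ x, ∃ m ∈ combo β x q, T x ∈ prox f l₂ m) →
      FixedPointsAre κ T D (argmin f ∩ argmin g) ∧
      ConvergenceNear T D (argmin f ∩ argmin g) μ
        (fun c => alphaComp c (alphaProx c * β) (alphaProx c))
        (fun c => (1 + β) * epsProx c + β * epsProx c ^ 2) (1 / (2 - β / 2))) ∧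
    -- (v) `T = P_C ∘ (β prox_{g,l} ⊕ (1 - β) Id)`
    (∀ l > (0 : ℝ), ∀ β ∈ Ioc (0 : ℝ) 1, ∀ C : Set G, IsClosed C → IsGeodesicallyConvex C →
      (∀ x ∈ D, ∃ q ∈ prox g l x, ∃ m ∈ combo β x q, T x ∈ proj C m) →
      FixedPointsAre κ T D (C ∩ argmin g) ∧
      ConvergenceNear T D (C ∩ argmin g) μ
        (fun c => 1 / (c / 2 * (1 - alphaProx c * β) + 1)) (fun c => β * epsProx c)
        (1 / (2 - β / 2))) := by
  have hTD : IsSubregularSelfMap T D μ := ⟨hD, hT, hμ, hreg⟩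
  have hprox_f {l : ℝ} (hl : l > 0) := hf.isFootPointMap_prox hG hκ hl
  have hprox_g {l : ℝ} (hl : l > 0) := hg.isFootPointMap_prox hG hκ hl
  exact ⟨fun l₁ hl₁ l₂ hl₂ h =>
      fixedPointsAre_and_convergenceNear_comp hG hκ hTD (hprox_f hl₂) (hprox_g hl₁) h,
    fun l hl T₀ α₀ hα₀ h hfirm hq y hy =>
      let ⟨hrate, hrate', hlim, hlt, δ, hδ, hasymp⟩ :=
        convergenceAlong_comp_restriction hG hκ hTD (hprox_f hl) hα₀ h hfirm hq hy
      ⟨fun c hc ε₀ hε₀ => hrate (c, ε₀) ⟨hc, hε₀⟩, hrate', hlim, hlt, δ, hδ, hasymp y rfl⟩,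
    fun l hl β hβ h => fixedPointsAre_and_convergenceNear_relaxation hG hκ hTD (hprox_f hl) hβ h,
    fun l₁ hl₁ l₂ hl₂ β hβ h =>
      fixedPointsAre_and_convergenceNear_comp_relaxation_alphaProx hG hκ hTD (hprox_f hl₂)
        (hprox_g hl₁) hβ fun x hx => mem_composition_relaxation.2 (h x hx),
    fun l hl β hβ C _ hC h =>
      fixedPointsAre_and_convergenceNear_comp_relaxation_half hG hκ hTD hC.isFootPointMap_proj
        (hprox_g hl) hβ fun x hx => mem_composition_relaxation.2 (h x hx)⟩
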